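/- Notation. For $b\in\mathbb R$ and a finite (non-negative) Borel measure $\nu_\sigma$ on $\mathbb R$, with $\sigma\ge 0$ given by $\sigma^2=\nu_\sigma(\{0\})$, let $$\varphi(u)=\varphi(u;b,\nu_\sigma)=\exp\Big(iub+\int_{\mathbb R}\frac{e^{iux}-1-iux}{x^2}\,\nu_\sigma(dx)\Big),\qquad u\in\mathbb R,$$ where the integrand is read as $-u^2/2$ at $x=0$. The probability measure on $\mathbb R$ with characteristic function $\varphi(\cdot;b,\nu_\sigma)$ is the law of a unit-time increment of the Lévy process with mean $b$, volatility $\sigma$ and jump measure $\nu$, where $\nu_\sigma(dx)=\sigma^2\delta_0(dx)+x^2\nu(dx)$. Let $P_{b,\nu_\sigma}$ denote probability when $n$ independent increments with this law are observed. For $s>0$ let $F_s$ be the set of continuous integrable $f:\mathbb R\to\mathbb R$ with $\int(1+|u|)^s|\mathcal Ff(u)|\,du\le 1$, where $\mathcal Ff(u)=\int f(x)e^{iux}\,dx$, and for finite Borel measures put $$\ell_s(\mu',\mu)=\sup_{f\in F_s}\Big|\int f\,d\mu'-\int f\,d\mu\Big|.$$ For $\sigma,C,\bar C,\alpha>0$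 and $\beta\ge 0$ define the following classes of finite Borel measures on $\mathbb R$: - $\mathcal A(C,\sigma)$: all $\nu_\sigma$ with $\nu_\sigma(\{0\})=\sigma^2$ and $\nu_\sigma(\mathbb R)\le C$; - $\mathcal B(C,\bar C,\alpha)$: all $\nu_\sigma$ with $\nu_\sigma(\{0\})=0$, $\nu_\sigma(\mathbb R)\le C$ and $|\varphi(u)|\ge \bar C^{-1}e^{-\alpha|u|}$ for all $u\in\mathbb R$; - $\mathcal C(C,\bar C,\beta)$: all $\nu_\sigma$ with $\nu_\sigma(\{0\})=0$, $\nu_\sigma(\mathbb R)\le C$ and $|\varphi(u)|\ge \bar C^{-1}(1+|u|)^{-\beta}$ for all $u\in\mathbb R$. ($|\varphi|$ does not depend on $b$.) An estimator $\widetilde\nu_{\sigma,n}$ is a map from the $n$ observed increments to the finite Borel measures on $\mathbb R$ (measurable or not; non-measurable events are given their outer probability). **Theorem 4.4.** (a) For every $\sigma>0$ and all $C$ large enough (depending on $\sigma$), for every $b\in\mathbb R$ and $s>0$ there is $\varepsilon>0$ with $$\liminf_{n\to\infty}\inf_{\widetilde\nu_{\sigma,n}}\sup_{\nu_\sigma\in\mathcal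 A(C,\sigma)}P_{b,\nu_\sigma}\big((\log n)^{s/2}\,\ell_s(\widetilde\nu_{\sigma,n},\nu_\sigma)>\varepsilon\big)>0.$$ Moreover, for all $C,\bar C$ large enough the following two statements hold. (b) For every $\alpha>0$, $b\in\mathbb R$ and $s>0$ there is $\varepsilon>0$ with $$\liminf_{n\to\infty}\inf_{\widetilde\nu_{\sigma,n}}\sup_{\nu_\sigma\in\mathcal B(C,\bar C,\alpha)}P_{b,\nu_\sigma}\big((\log n)^{s}\,\ell_s(\widetilde\nu_{\sigma,n},\nu_\sigma)>\varepsilon\big)>0.$$ (c) For every $\beta\ge 0$, $b\in\mathbb R$ and $s>0$ there is $\varepsilon>0$ with $$\liminf_{n\to\infty}\inf_{\widetilde\nu_{\sigma,n}}\sup_{\nu_\sigma\in\mathcal C(C,\bar C,\beta)}P_{b,\nu_\sigma}\big(n^{(s/(2\beta))\wedge(1/2)}\,\ell_s(\widetilde\nu_{\sigma,n},\nu_\sigma)>\varepsilon\big)>0,$$ where the exponent is $1/2$ if $\beta=0$. -/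

import Mathlib

open MeasureTheory Filter
open scoped ENNReal

noncomputable section

namespace LevyLower

/-- The integrand `(e^{iux} - 1 - iux) / x²` of the characteristic exponent, continuously extended
by `-u²/2` at `x = 0`. -/
def levyKernel (u x : ℝ) : ℂ :=
  if x = 0 then -((u : ℂ) ^ 2) / 2
  else (Complex.exp (Complex.I * u * x) - 1 - Complex.I * u * x) / (x : ℂ) ^ 2

/-- The characteristic exponent `Ψ(u; b, ν) = iub + ∫ (e^{iux} - 1 - iux) / x² ν(dx)`, where `ν` is
the finite measure `σ² δ₀(dx) + x² (jump measure)(dx)`. -/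
def levyExponent (b : ℝ) (ν : FiniteMeasure ℝ) (u : ℝ) : ℂ :=
  Complex.I * u * b + ∫ x, levyKernel u x ∂(ν : Measure ℝ)

/-- The characteristic function `φ(u; b, ν) = exp Ψ(u; b, ν)` of an increment over unit time. -/
def levyCharFun (b : ℝ) (ν : FiniteMeasure ℝ) (u : ℝ) : ℂ :=
  Complex.exp (levyExponent b ν u)

/-- `P` is the law `P_{b,ν}` of an increment over unit time: the probability measure (unique, since
characteristic functions determine laws) with characteristic function `φ(·; b, ν)`. -/
def IsLevyLaw (b : ℝ) (ν : FiniteMeasure ℝ) (P : ProbabilityMeasure ℝ) : Prop :=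
  ∀ u : ℝ, charFun (P : Measure ℝ) u = levyCharFun b ν u

/-- The Fourier transform `𝓕f(u) = ∫ f(x) e^{iux} dx`. -/
def fourierT (f : ℝ → ℝ) (u : ℝ) : ℂ :=
  ∫ x : ℝ, (f x : ℂ) * Complex.exp (Complex.I * u * x)

/-- The class `F_s` of continuous integrable test functions `f` with
`∫ (1 + |u|)^s |𝓕f(u)| du ≤ 1`. -/
def testClass (s : ℝ) : Set (ℝ → ℝ) :=
  {f | Continuous f ∧ Integrable f ∧
    ∫⁻ u : ℝ, ENNReal.ofReal ((1 + |u|) ^ s) * ‖fourierT f u‖ₑ ≤ 1}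

/-- The loss `ℓ_s(μ', μ) = sup_{f ∈ F_s} |∫ f dμ' - ∫ f dμ|`. -/
def loss (s : ℝ) (μ' μ : FiniteMeasure ℝ) : ℝ≥0∞ :=
  ⨆ f ∈ testClass s,
    ENNReal.ofReal |(∫ x, f x ∂(μ' : Measure ℝ)) - ∫ x, f x ∂(μ : Measure ℝ)|

/-- Gaussian part: `ν({0}) = σ²` and `ν(ℝ) ≤ C` (used with `σ > 0`). -/
def classA (C σ : ℝ) : Set (FiniteMeasure ℝ) :=
  {ν | (ν : Measure ℝ) {0} = ENNReal.ofReal (σ ^ 2) ∧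
    (ν : Measure ℝ) Set.univ ≤ ENNReal.ofReal C}

/-- No Gaussian part, and a characteristic function that decays at most exponentially. Its modulus
does not depend on the drift `b`. -/
def classB (b C Cbar α : ℝ) : Set (FiniteMeasure ℝ) :=
  {ν | (ν : Measure ℝ) {0} = 0 ∧ (ν : Measure ℝ) Set.univ ≤ ENNReal.ofReal C ∧
    ∀ u : ℝ, Cbar⁻¹ * Real.exp (-α * |u|) ≤ ‖levyCharFun b ν u‖}

/-- No Gaussian part, and a characteristic function that decays at most polynomially. Its modulus
does not depend on the drift `b`. -/
def classC (b C Cbar β : ℝ) : Set (FiniteMeasure ℝ) :=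
  {ν | (ν : Measure ℝ) {0} = 0 ∧ (ν : Measure ℝ) Set.univ ≤ ENNReal.ofReal C ∧
    ∀ u : ℝ, Cbar⁻¹ * (1 + |u|) ^ (-β) ≤ ‖levyCharFun b ν u‖}

/-- An estimator of `ν` based on `n` observed increments. All maps are admitted, so that an infimum
over estimators is also a lower bound for the measurable ones. -/
abbrev Estimator (n : ℕ) : Type := (Fin n → ℝ) → FiniteMeasure ℝ

/-- The minimax probability
`inf_{ν̃} sup_{ν ∈ N} P_{b,ν}(r ℓ_s(ν̃, ν) > ε)` for `n` independent increments with law `P_{b,ν}`,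
the infimum being over all estimators `ν̃` based on `n` observations. -/
def minimaxProb (b s : ℝ) (N : Set (FiniteMeasure ℝ)) (r ε : ℝ) (n : ℕ) : ℝ≥0∞ :=
  ⨅ est : Estimator n, ⨆ ν ∈ N, ⨆ P : ProbabilityMeasure ℝ, ⨆ _ : IsLevyLaw b ν P,
    Measure.pi (fun _ : Fin n => (P : Measure ℝ))
      {x | ENNReal.ofReal ε < ENNReal.ofReal r * loss s (est x) ν}

/-- The exponent `(s / 2β) ∧ (1/2)` of the polynomial case, where `s / 0 = ∞` for `s > 0`. -/
def polyExponent (s β : ℝ) : ℝ :=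
  if β = 0 then 1 / 2 else min (s / (2 * β)) (1 / 2)

end LevyLower

end

/-! The proof is Le Cam's two-point method, with both hypotheses built from Gaussian mixtures so
that every comparison becomes an inequality between positive measures.

Increments have the law `compound B ρ`: a base law `B` convolved with a unit-rate compound Poisson
law with jump distribution `ρ`. Under one hypothesis `ρ` is half standard Gaussian and half atom at
zero. Under the other the Gaussian half is reweighted by `1 + κ cos (U x)`, and the atom absorbs the
change of mass. The atom is invisible after multiplication by `x²`, so the two measures differ by `κ
x² cos (U x) / 2` times the standard Gaussian law. A test function oscillating at frequency `U`,
normalised by a multiple of `(1 + U) ^ (-s)`, detects a separation of order `κ U ^ (-s)`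
(`exists_le_loss`).

Statistically the perturbation is damped. Convolution of a Gaussian law of variance `v` with the
reweighted one is again a reweighted Gaussian law, of amplitude `κ damping U v`
(`gaussianReal_conv_tilt`). If the mixture `B` damps by a factor `δ`, then `B ∗ ρ₁` and `B ∗ ρ₀`
differ by at most `κ δ` times `B ∗ ρ₀`. This passes to convolution powers with a factor `2 ^ N`
(`convPow_domination`), and Poisson averaging bounds the χ² distance by `(κ δ)² e³`
(`sqDom_compound`). Tensorisation keeps `n` observations indistinguishable as long as `n (κ δ)²`
stays bounded (`exists_le_minimaxProb`).

It remains to choose `B`, with random variance `σ2 + τ2 M + N`. The Poisson variable `N` makes the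
mixture dominate a fixed Gaussian law, against which damping can be measured; the compound Poisson
`M` shapes the decay of the characteristic function. By subordination both are themselves compound
Poisson components with Gaussian jumps. With `κ = 1` and `δ` of order `n ^ (-1/2)`: a Gaussian
component allows `U ~ √(log n)`; a Poisson `M` with characteristic function about `e ^ (-α|u|)` up
to frequency `U` allows `U ~ log n`; a negative binomial `M` with decay `|u| ^ (-β)` in that range
allows `U ~ n ^ (1/(2β))`. The parametric rate uses fixed `U` and `κ = n ^ (-1/2)`. The intensities
of `M` may depend on `n`, while the class constants stay uniform. -/

noncomputable section

namespace LevyLower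

open ProbabilityTheory
open scoped NNReal

/-! ### χ² domination, tensorisation and Le Cam's bound -/

section SecondMoment

variable {X Y : Type*} [MeasurableSpace X] [MeasurableSpace Y]

/-- `ν` defines a functional of squared norm at most `K` on `L²(μ)`: equivalently, the density of
`ν` with respect to `μ` has second moment at most `K`. -/
def SqDom (K : ℝ≥0∞) (μ ν : Measure X) : Prop :=
  ∀ h : X → ℝ≥0∞, Measurable h → (∫⁻ x, h x ∂ν) ^ 2 ≤ K * ∫⁻ x, h x ^ 2 ∂μ

theorem lintegral_mul_sq_le (μ : Measure X) {f g : X → ℝ≥0∞} (hf : Measurable f)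
    (hg : Measurable g) :
    (∫⁻ x, f x * g x ∂μ) ^ 2 ≤ (∫⁻ x, f x ^ 2 ∂μ) * ∫⁻ x, g x ^ 2 ∂μ := by
  have h := ENNReal.lintegral_mul_le_Lp_mul_Lq μ (p := 2) (q := 2) (by
    constructor <;> norm_num) hf.aemeasurable hg.aemeasurable
  have h2 := pow_le_pow_left' h 2
  refine h2.trans (le_of_eq ?_)
  rw [mul_pow, ← ENNReal.rpow_natCast, ← ENNReal.rpow_mul, ← ENNReal.rpow_natCast,
    ← ENNReal.rpow_mul]
  norm_num

theorem SqDom.refl (μ : Measure X) [IsProbabilityMeasure μ] : SqDom 1 μ μ := by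
  intro h hh
  have := lintegral_mul_sq_le μ hh (measurable_const (a := (1 : ℝ≥0∞)))
  simpa using this

/-- Apply the bound for the second factor on each fibre, after using the bound for the first factor
on the fibre integrals. Iterated by `SqDom.pi`, this turns a bound for one observation into its
`n`-th power for a sample. -/
theorem SqDom.prod {K L : ℝ≥0∞} {μ ν : Measure X} {μ' ν' : Measure Y} [SFinite μ] [SFinite ν]
    [SFinite μ'] [SFinite ν'] (h₁ : SqDom K μ ν) (h₂ : SqDom L μ' ν') :
    SqDom (K * L) (μ.prod μ') (ν.prod ν') := by
  intro h hh
  rw [lintegral_prod _ hh.aemeasurable, lintegral_prod _ (hh.pow_const 2).aemeasurable]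
  refine (h₁ _ hh.lintegral_prod_right').trans ?_
  rw [mul_assoc]
  gcongr
  rw [← lintegral_const_mul _ (hh.pow_const 2).lintegral_prod_right']
  refine lintegral_mono fun x => ?_
  exact h₂ _ (hh.comp measurable_prodMk_left)

theorem SqDom.of_measurePreserving {K : ℝ≥0∞} {μ ν : Measure X} {μ' ν' : Measure Y}
    (h : SqDom K μ' ν') (e : X ≃ᵐ Y) (hμ : MeasurePreserving e μ μ')
    (hν : MeasurePreserving e ν ν') : SqDom K μ ν := by
  intro f hf
  have := h (f ∘ e.symm) (hf.comp e.symm.measurable)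
  rw [← hμ.lintegral_comp_emb e.measurableEmbedding,
    ← hν.lintegral_comp_emb e.measurableEmbedding] at this
  simpa using this

theorem SqDom.pi {K : ℝ≥0∞} {μ ν : Measure X} [IsProbabilityMeasure μ] [IsProbabilityMeasure ν]
    (h : SqDom K μ ν) (n : ℕ) :
    SqDom (K ^ n) (Measure.pi fun _ : Fin n => μ) (Measure.pi fun _ : Fin n => ν) := by
  induction n with
  | zero =>
    rw [Measure.pi_of_empty, Measure.pi_of_empty, pow_zero]
    exact SqDom.refl _
  | succ n ih =>
    rw [pow_succ']
    exact (h.prod ih).of_measurePreserving _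
      (measurePreserving_piFinSuccAbove (fun _ : Fin (n + 1) => μ) 0)
      (measurePreserving_piFinSuccAbove (fun _ : Fin (n + 1) => ν) 0)

/-- Cauchy-Schwarz for mixtures. -/
theorem sqDom_sum (p r : ℕ → ℝ≥0∞) (A : ℕ → Measure X) [∀ i, IsProbabilityMeasure (A i)] :
    SqDom (∑' i, p i * r i ^ 2) (Measure.sum fun i => p i • A i)
      (Measure.sum fun i => (p i * r i) • A i) := by
  intro h hh
  -- Cauchy-Schwarz on the index set with masses `p i`, pairing `r` with the means of `h` under the
  -- components; Cauchy-Schwarz inside each component then finishes.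
  have key := lintegral_mul_sq_le (Measure.sum fun i : ℕ => p i • Measure.dirac i)
    (f := r) (g := fun i => ∫⁻ x, h x ∂(A i)) (measurable_of_countable _)
    (measurable_of_countable _)
  simp only [lintegral_sum_measure, lintegral_smul_measure, lintegral_dirac, smul_eq_mul] at key ⊢
  simp only [← mul_assoc] at key
  refine key.trans ?_
  gcongr with i
  simpa using SqDom.refl (A i) h hh

theorem SqDom.smul {M : ℝ≥0∞} {μ D : Measure X} (h : SqDom M μ D) (c : ℝ≥0∞) :
    SqDom (c ^ 2 * M) μ (c • D) := by
  intro f hf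
  rw [lintegral_smul_measure, smul_eq_mul, mul_pow, mul_assoc]
  gcongr
  exact h f hf

theorem SqDom.absolutelyContinuous {M : ℝ≥0∞} {μ D : Measure X} (h : SqDom M μ D) : D ≪ μ := by
  refine Measure.AbsolutelyContinuous.mk fun s hs hμ => ?_
  have := h (s.indicator 1) (measurable_one.indicator hs)
  have h2 : ∀ x, (s.indicator (1 : X → ℝ≥0∞) x) ^ 2 = s.indicator 1 x := by
    intro x; by_cases hx : x ∈ s <;> simp [hx]
  simp only [h2, lintegral_indicator_one hs, hμ, mul_zero] at this
  simpa using this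

/-- If `|ν - μ| ≤ D` and `D` is bounded by `M` on `L²(μ)`, then `χ²(ν, μ) ≤ M`. -/
theorem sqDom_of_le_add {M : ℝ≥0∞} (hM : M ≠ ∞) {μ ν D : Measure X} [IsProbabilityMeasure μ]
    [IsProbabilityMeasure ν] (h₁ : ν ≤ μ + D) (h₂ : μ ≤ ν + D) (hD : SqDom M μ D) :
    SqDom (1 + M) μ ν := by
  intro h hh
  by_cases hfin : ∫⁻ x, h x ^ 2 ∂μ = ∞
  · rw [hfin, ENNReal.mul_top (by simp)]; exact le_top
  have hDμ := hD.absolutelyContinuous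
  have hνμ : ν ≪ μ := (Measure.absolutelyContinuous_of_le h₁).trans
    (Measure.AbsolutelyContinuous.rfl.add_left hDμ)
  have hae : ∀ᵐ x ∂μ, h x < ∞ := by
    filter_upwards [ae_lt_top (hh.pow_const 2) hfin] with x hx
    by_contra hc
    simp [not_lt_top_iff.1 hc] at hx
  set f : X → ℝ := fun x => (h x).toReal with hf
  have hfm : Measurable f := hh.ennreal_toReal
  have hf0 : ∀ x, 0 ≤ f x := fun x => ENNReal.toReal_nonneg
  have hhf : ∀ᵐ x ∂μ, h x = ENNReal.ofReal (f x) := by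
    filter_upwards [hae] with x hx
    rw [hf, ENNReal.ofReal_toReal hx.ne]
  have hsq : ∫⁻ x, h x ^ 2 ∂μ = ∫⁻ x, ENNReal.ofReal (f x ^ 2) ∂μ := by
    refine lintegral_congr_ae ?_
    filter_upwards [hhf] with x hx
    rw [hx, ENNReal.ofReal_pow (hf0 x)]
  have hf2 : Integrable (fun x => f x ^ 2) μ := by
    refine ⟨(hfm.pow_const 2).aestronglyMeasurable, ?_⟩
    rw [hasFiniteIntegral_iff_ofReal (Eventually.of_forall fun x => sq_nonneg _), ← hsq]
    exact lt_of_le_of_ne le_top hfin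
  have hLp : MemLp f 2 μ := (memLp_two_iff_integrable_sq hfm.aestronglyMeasurable).2 hf2
  have hfμ : Integrable f μ := hLp.integrable (by norm_num)
  have hfD : Integrable f D := by
    refine ⟨hfm.aestronglyMeasurable, ?_⟩
    rw [hasFiniteIntegral_iff_ofReal (Eventually.of_forall hf0),
      ← lintegral_congr_ae (hDμ.ae_le hhf)]
    have := hD h hh
    have h3 : M * ∫⁻ x, h x ^ 2 ∂μ < ∞ := ENNReal.mul_lt_top hM.lt_top (lt_top_iff_ne_top.2 hfin)
    by_contra hc
    rw [not_lt_top_iff.1 hc] at this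
    simp at this
    exact absurd this h3.ne
  have hDfin : IsFiniteMeasure D := by
    refine ⟨?_⟩
    have := hD (fun _ => 1) measurable_const
    simp at this
    by_contra hc
    rw [not_lt_top_iff.1 hc] at this
    simp at this
    exact hM this
  have hfν : Integrable f ν := Integrable.mono_measure (hfμ.add_measure hfD) h₁
  set m : ℝ := ∫ x, f x ∂μ with hm
  -- Centring under `μ` is what yields `1 + M`: since `k` has `μ`-mean zero, its `ν`-mean is
  -- entirely due to `D`, so it is at most `∫ |k| ∂D`, whose square is at most `M` times the
  -- variance.
  set k : X → ℝ := fun x => f x - m with hk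
  have hkm : Measurable k := hfm.sub_const m
  have hkμ : Integrable k μ := hfμ.sub (integrable_const m)
  have hkD : Integrable k D := hfD.sub (integrable_const m)
  have hkν : Integrable k ν := hfν.sub (integrable_const m)
  have hk0 : ∫ x, k x ∂μ = 0 := by
    rw [hk, integral_sub hfμ (integrable_const m)]
    simp [← hm]
  have hk2 : Integrable (fun x => k x ^ 2) μ := by
    have : (fun x => k x ^ 2) = fun x => f x ^ 2 - 2 * m * f x + m ^ 2 := by
      ext x; simp only [hk]; ring
    rw [this]
    exact (hf2.sub (hfμ.const_mul _)).add (integrable_const _)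
  have hV : ∫ x, k x ^ 2 ∂μ = ∫ x, f x ^ 2 ∂μ - m ^ 2 := by
    have : (fun x => k x ^ 2) = fun x => f x ^ 2 - 2 * m * f x + m ^ 2 := by
      ext x; simp only [hk]; ring
    have i1 : Integrable (fun x => f x ^ 2 - 2 * m * f x) μ := hf2.sub (hfμ.const_mul _)
    rw [this, integral_add i1 (integrable_const _), integral_sub hf2 (hfμ.const_mul _),
      integral_const_mul]
    simp [← hm]
    ring
  set t : ℝ := ∫ x, |k x| ∂D with ht
  have ht0 : 0 ≤ t := integral_nonneg fun x => abs_nonneg _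
  have htM : t ^ 2 ≤ M.toReal * ∫ x, k x ^ 2 ∂μ := by
    have := hD (fun x => ENNReal.ofReal |k x|) (by fun_prop)
    rw [← ofReal_integral_eq_lintegral_ofReal hkD.abs (Eventually.of_forall fun x => abs_nonneg _)]
      at this
    have h4 : ∀ x, ENNReal.ofReal |k x| ^ 2 = ENNReal.ofReal (k x ^ 2) := by
      intro x; rw [← ENNReal.ofReal_pow (abs_nonneg _), sq_abs]
    simp only [h4] at this
    rw [← ofReal_integral_eq_lintegral_ofReal hk2 (Eventually.of_forall fun x => sq_nonneg _),
      ← ENNReal.ofReal_toReal hM, ← ENNReal.ofReal_mul ENNReal.toReal_nonneg,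
      ← ENNReal.ofReal_pow ht0] at this
    exact (ENNReal.ofReal_le_ofReal_iff
      (mul_nonneg ENNReal.toReal_nonneg (integral_nonneg fun x => sq_nonneg _))).1 this
  have hkt : ∫ x, k x ∂ν ≤ t := by
    have e1 : ∀ x, k x = max (k x) 0 - max (-k x) 0 := by
      intro x; rcases le_total (k x) 0 with hx | hx <;> simp [hx]
    have e2 : ∀ x, |k x| = max (k x) 0 + max (-k x) 0 := by
      intro x; rcases le_total (k x) 0 with hx | hx <;> simp [hx, abs_of_nonneg, abs_of_nonpos]
    have hpμ : Integrable (fun x => max (k x) 0) μ := hkμ.pos_part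
    have hnμ : Integrable (fun x => max (-k x) 0) μ := hkμ.neg_part
    have hpD : Integrable (fun x => max (k x) 0) D := hkD.pos_part
    have hnD : Integrable (fun x => max (-k x) 0) D := hkD.neg_part
    have hpν : Integrable (fun x => max (k x) 0) ν := hkν.pos_part
    have hnν : Integrable (fun x => max (-k x) 0) ν := hkν.neg_part
    have i1 : ∫ x, max (k x) 0 ∂ν ≤ ∫ x, max (k x) 0 ∂μ + ∫ x, max (k x) 0 ∂D := by
      rw [← integral_add_measure hpμ hpD]
      exact integral_mono_measure h₁ (Eventually.of_forall fun x => le_max_right _ _)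
        (hpμ.add_measure hpD)
    have i2 : ∫ x, max (-k x) 0 ∂μ ≤ ∫ x, max (-k x) 0 ∂ν + ∫ x, max (-k x) 0 ∂D := by
      rw [← integral_add_measure hnν hnD]
      exact integral_mono_measure h₂ (Eventually.of_forall fun x => le_max_right _ _)
        (hnν.add_measure hnD)
    have i3 : ∫ x, k x ∂ν = ∫ x, max (k x) 0 ∂ν - ∫ x, max (-k x) 0 ∂ν := by
      rw [← integral_sub hpν hnν]; exact integral_congr_ae (Eventually.of_forall e1)
    have i4 : ∫ x, k x ∂μ = ∫ x, max (k x) 0 ∂μ - ∫ x, max (-k x) 0 ∂μ := by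
      rw [← integral_sub hpμ hnμ]; exact integral_congr_ae (Eventually.of_forall e1)
    have i5 : t = ∫ x, max (k x) 0 ∂D + ∫ x, max (-k x) 0 ∂D := by
      rw [← integral_add hpD hnD]; exact integral_congr_ae (Eventually.of_forall e2)
    linarith
  have hm0 : 0 ≤ m := integral_nonneg hf0
  have hfk : ∫ x, f x ∂ν ≤ m + t := by
    have : ∫ x, k x ∂ν = ∫ x, f x ∂ν - m := by
      simp [hk, integral_sub hfν (integrable_const m)]
    linarith
  have hreal : (∫ x, f x ∂ν) ^ 2 ≤ (1 + M.toReal) * ∫ x, f x ^ 2 ∂μ := by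
    have hV0 : 0 ≤ ∫ x, k x ^ 2 ∂μ := integral_nonneg fun x => sq_nonneg _
    have hM0 : 0 ≤ M.toReal := ENNReal.toReal_nonneg
    set V := ∫ x, k x ^ 2 ∂μ
    have hW : ∫ x, f x ^ 2 ∂μ = V + m ^ 2 := by linarith
    rw [hW]
    -- AM-GM for `M m²` and `V`, using `t² ≤ M V`. Expanding `(m + t)²` then gives at most `(1 + M)
    -- (m² + V)`.
    have hc : 2 * m * t ≤ M.toReal * m ^ 2 + V := by
      refine abs_le_of_sq_le_sq' ?_ (by positivity) |>.2
      nlinarith [sq_nonneg (M.toReal * m ^ 2 - V), mul_le_mul_of_nonneg_left htM (sq_nonneg m)]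
    have h0 : 0 ≤ ∫ x, f x ∂ν := integral_nonneg hf0
    nlinarith [pow_le_pow_left₀ h0 hfk 2]
  rw [lintegral_congr_ae (hνμ.ae_le hhf), hsq,
    ← ofReal_integral_eq_lintegral_ofReal hfν (Eventually.of_forall hf0),
    ← ofReal_integral_eq_lintegral_ofReal hf2 (Eventually.of_forall fun x => sq_nonneg _),
    ← ENNReal.ofReal_toReal hM, ← ENNReal.ofReal_one,
    ← ENNReal.ofReal_add zero_le_one ENNReal.toReal_nonneg,
    ← ENNReal.ofReal_mul (by positivity), ← ENNReal.ofReal_pow (integral_nonneg hf0)]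
  exact ENNReal.ofReal_le_ofReal hreal

/-- The two-point bound of Le Cam. -/
theorem SqDom.two_point {K : ℝ≥0∞} (hK : 1 ≤ K) (hK' : K ≠ ∞) {μ ν : Measure X}
    [IsProbabilityMeasure μ] [IsProbabilityMeasure ν] (h : SqDom K μ ν) {E F : Set X}
    (hEF : E ∪ F = Set.univ) : (4 * K)⁻¹ ≤ max (μ E) (ν F) := by
  -- Estimators need not be measurable, so `E` is replaced by a measurable hull of the same
  -- `μ`-measure, whose complement still lies in `F`.
  set t := toMeasurable μ E
  have ht : MeasurableSet t := measurableSet_toMeasurable μ E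
  have hμt : μ t = μ E := measure_toMeasurable E
  have htF : tᶜ ⊆ F := fun x hx => by
    have : x ∈ E ∪ F := hEF ▸ Set.mem_univ x
    exact this.resolve_left fun hE => hx (subset_toMeasurable μ E hE)
  have h2 : ∀ x, (t.indicator (1 : X → ℝ≥0∞) x) ^ 2 = t.indicator 1 x := by
    intro x; by_cases hx : x ∈ t <;> simp [hx]
  have hsq := h (t.indicator 1) (measurable_one.indicator ht)
  simp only [h2, lintegral_indicator_one ht, hμt] at hsq
  have hK0 : K ≠ 0 := (zero_lt_one.trans_le hK).ne'
  -- If `ν t ≥ 1/2`, domination gives `1/4 ≤ K μ E`; otherwise `F` has `ν`-measure at least `1/2`.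
  rcases le_total (2⁻¹ : ℝ≥0∞) (ν t) with hc | hc
  · refine le_max_of_le_left ?_
    have h4 : (4⁻¹ : ℝ≥0∞) ≤ K * μ E := by
      refine le_trans (le_trans (le_of_eq ?_) (pow_le_pow_left' hc 2)) hsq
      rw [← ENNReal.inv_pow]; norm_num
    rw [ENNReal.mul_inv (by simp) (by simp), mul_comm]
    calc K⁻¹ * 4⁻¹ ≤ K⁻¹ * (K * μ E) := by gcongr
      _ = μ E := by rw [← mul_assoc, ENNReal.inv_mul_cancel hK0 hK', one_mul]
  · refine le_max_of_le_right ?_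
    have h5 : (2⁻¹ : ℝ≥0∞) ≤ ν tᶜ := by
      rw [prob_compl_eq_one_sub ht, ← ENNReal.one_sub_inv_two]
      gcongr
    refine le_trans ?_ (h5.trans (measure_mono htF))
    refine ENNReal.inv_le_inv.2 ?_
    calc (2 : ℝ≥0∞) ≤ 4 * 1 := by norm_num
      _ ≤ 4 * K := by gcongr

end SecondMoment

/-! ### Convolution powers, mixtures and compound Poisson laws -/

section Convolution

theorem conv_mono {μ μ' ν ν' : Measure ℝ} [SFinite ν'] (h₁ : μ ≤ μ') (h₂ : ν ≤ ν') :
    μ ∗ ν ≤ μ' ∗ ν' :=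
  Measure.map_mono (Measure.prod_mono h₁ h₂) measurable_add

theorem add_smul_conv (μ ν ρ : Measure ℝ) [IsFiniteMeasure μ] [IsFiniteMeasure ν]
    [IsFiniteMeasure ρ] (c : ℝ≥0∞) (hc : c ≠ ∞) :
    (μ + c • ν) ∗ ρ = μ ∗ ρ + c • (ν ∗ ρ) := by
  have : IsFiniteMeasure (c • ν) := ν.smul_finite hc
  rw [Measure.add_conv, Measure.conv_smul_left]

/-- Convolution powers of a measure on the line. -/
def convPow (ρ : Measure ℝ) : ℕ → Measure ℝ
  | 0 => Measure.dirac 0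
  | N + 1 => convPow ρ N ∗ ρ

instance convPow.isProbabilityMeasure (ρ : Measure ℝ) [IsProbabilityMeasure ρ] (N : ℕ) :
    IsProbabilityMeasure (convPow ρ N) := by
  induction N with
  | zero => exact Measure.dirac.isProbabilityMeasure
  | succ N ih => rw [convPow]; infer_instance

theorem charFun_convPow (ρ : Measure ℝ) [IsProbabilityMeasure ρ] (N : ℕ) (u : ℝ) :
    charFun (convPow ρ N) u = charFun ρ u ^ N := by
  induction N with
  | zero => simp [convPow, charFun_dirac]
  | succ N ih => rw [convPow, charFun_conv, ih, pow_succ]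

/-- If `|B * ρ₁ - B * ρ₀| ≤ δ B * ρ₀`, then the same holds for the `N`-th convolution powers of
`ρ₁` and `ρ₀`, with the factor `2 ^ N δ`. -/
theorem convPow_domination {B ρ₀ ρ₁ : Measure ℝ} [IsProbabilityMeasure B]
    [IsProbabilityMeasure ρ₀] [IsProbabilityMeasure ρ₁] {δ : ℝ≥0∞} (hδ : δ ≠ ∞)
    (hρ : ρ₁ ≤ (2 : ℝ≥0∞) • ρ₀) (h₁ : B ∗ ρ₁ ≤ B ∗ ρ₀ + δ • (B ∗ ρ₀))
    (h₂ : B ∗ ρ₀ ≤ B ∗ ρ₁ + δ • (B ∗ ρ₀)) (N : ℕ) :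
    B ∗ convPow ρ₁ N ≤ B ∗ convPow ρ₀ N + (((2 ^ N - 1 : ℕ) : ℝ≥0∞) * δ) • (B ∗ convPow ρ₀ N) ∧
    B ∗ convPow ρ₀ N ≤ B ∗ convPow ρ₁ N + (((2 ^ N - 1 : ℕ) : ℝ≥0∞) * δ) • (B ∗ convPow ρ₀ N) := by
  induction N with
  | zero => simp [convPow]
  | succ N ih =>
    obtain ⟨ih₁, ih₂⟩ := ih
    set r : ℝ≥0∞ := ((2 ^ N - 1 : ℕ) : ℝ≥0∞) with hr
    have hrt : r * δ ≠ ∞ := ENNReal.mul_ne_top (ENNReal.natCast_ne_top _) hδ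
    -- The recursion for the error: one new `δ` from exchanging the last factor, plus the old error
    -- convolved with `ρ₁ ≤ 2 ρ₀`, hence doubled.
    have hr' : (((2 ^ (N + 1) - 1 : ℕ) : ℝ≥0∞)) = 1 + 2 * r := by
      have : 2 ^ (N + 1) - 1 = 1 + 2 * (2 ^ N - 1) := by
        have := Nat.one_le_two_pow (n := N)
        rw [pow_succ]; omega
      rw [this, hr]; push_cast; ring
    have e₀ : B ∗ convPow ρ₀ (N + 1) = (B ∗ convPow ρ₀ N) ∗ ρ₀ := by
      rw [convPow, ← Measure.conv_assoc]
    have e₁ : B ∗ convPow ρ₁ (N + 1) = (B ∗ convPow ρ₁ N) ∗ ρ₁ := by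
      rw [convPow, ← Measure.conv_assoc]
    -- The single copy of `B` is moved next to the factor being exchanged, so it can smooth every
    -- factor in turn.
    have comm : ∀ ρ : Measure ℝ, IsProbabilityMeasure ρ →
        (B ∗ convPow ρ₀ N) ∗ ρ = (B ∗ ρ) ∗ convPow ρ₀ N := by
      intro ρ _
      rw [Measure.conv_assoc, Measure.conv_comm (convPow ρ₀ N) ρ, ← Measure.conv_assoc]
    have step : (B ∗ convPow ρ₀ N) ∗ ρ₁ ≤ (2 : ℝ≥0∞) • (B ∗ convPow ρ₀ (N + 1)) := by
      have : IsFiniteMeasure ((2 : ℝ≥0∞) • ρ₀) := ρ₀.smul_finite (by simp)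
      rw [e₀, ← Measure.conv_smul_right]
      exact conv_mono le_rfl hρ
    have a₁ : (B ∗ convPow ρ₀ N) ∗ ρ₁ ≤
        B ∗ convPow ρ₀ (N + 1) + δ • (B ∗ convPow ρ₀ (N + 1)) := by
      rw [comm ρ₁ inferInstance, e₀, comm ρ₀ inferInstance, ← add_smul_conv _ _ _ _ hδ]
      exact conv_mono h₁ le_rfl
    have a₂ : B ∗ convPow ρ₀ (N + 1) ≤
        (B ∗ convPow ρ₀ N) ∗ ρ₁ + δ • (B ∗ convPow ρ₀ (N + 1)) := by
      rw [comm ρ₁ inferInstance, e₀, comm ρ₀ inferInstance, ← add_smul_conv _ _ _ _ hδ]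
      exact conv_mono h₂ le_rfl
    have hcomb : δ • (B ∗ convPow ρ₀ (N + 1)) + (r * δ) • ((2 : ℝ≥0∞) • (B ∗ convPow ρ₀ (N + 1)))
        = ((1 + 2 * r) * δ) • (B ∗ convPow ρ₀ (N + 1)) := by
      rw [smul_smul, ← add_smul]
      congr 1; ring
    rw [hr', ← hcomb]
    constructor
    · rw [e₁]
      calc (B ∗ convPow ρ₁ N) ∗ ρ₁
          ≤ (B ∗ convPow ρ₀ N + (r * δ) • (B ∗ convPow ρ₀ N)) ∗ ρ₁ := conv_mono ih₁ le_rfl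
        _ = (B ∗ convPow ρ₀ N) ∗ ρ₁ + (r * δ) • ((B ∗ convPow ρ₀ N) ∗ ρ₁) :=
            add_smul_conv _ _ _ _ hrt
        _ ≤ (B ∗ convPow ρ₀ (N + 1) + δ • (B ∗ convPow ρ₀ (N + 1))) +
            (r * δ) • ((2 : ℝ≥0∞) • (B ∗ convPow ρ₀ (N + 1))) := by gcongr
        _ = _ := by rw [add_assoc]
    · calc B ∗ convPow ρ₀ (N + 1)
          ≤ (B ∗ convPow ρ₀ N) ∗ ρ₁ + δ • (B ∗ convPow ρ₀ (N + 1)) := a₂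
        _ ≤ ((B ∗ convPow ρ₁ N + (r * δ) • (B ∗ convPow ρ₀ N)) ∗ ρ₁) +
            δ • (B ∗ convPow ρ₀ (N + 1)) := by
            gcongr
            exact conv_mono ih₂ le_rfl
        _ = ((B ∗ convPow ρ₁ N) ∗ ρ₁ + (r * δ) • ((B ∗ convPow ρ₀ N) ∗ ρ₁)) +
            δ • (B ∗ convPow ρ₀ (N + 1)) := by
            rw [add_smul_conv _ _ _ _ hrt]
        _ ≤ ((B ∗ convPow ρ₁ N) ∗ ρ₁ + (r * δ) • ((2 : ℝ≥0∞) • (B ∗ convPow ρ₀ (N + 1)))) +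
            δ • (B ∗ convPow ρ₀ (N + 1)) := by gcongr
        _ = _ := by rw [e₁]; abel

theorem sum_measure_mono {X ι : Type*} [MeasurableSpace X] {μ ν : ι → Measure X}
    (h : ∀ i, μ i ≤ ν i) : Measure.sum μ ≤ Measure.sum ν := by
  refine Measure.le_iff.2 fun s hs => ?_
  rw [Measure.sum_apply _ hs, Measure.sum_apply _ hs]
  exact ENNReal.tsum_le_tsum fun i => h i s

theorem smul_sum_measure {X ι : Type*} [MeasurableSpace X] (c : ℝ≥0∞) (μ : ι → Measure X) :
    c • Measure.sum μ = Measure.sum fun i => c • μ i := by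
  ext s hs
  simp [Measure.sum_apply _ hs, ENNReal.tsum_mul_left]

section Mixture

variable {X ι : Type*} [MeasurableSpace X] {p : ι → ℝ} {A : ι → Measure X}

/-- The mixture of the measures `A i` with weights `p i`. -/
def mixture (p : ι → ℝ) (A : ι → Measure X) : Measure X :=
  Measure.sum fun i => ENNReal.ofReal (p i) • A i

theorem mixture_univ [∀ i, IsProbabilityMeasure (A i)] (hp : ∀ i, 0 ≤ p i) {c : ℝ}
    (hc : HasSum p c) : mixture p A Set.univ = ENNReal.ofReal c := by
  rw [mixture, Measure.sum_apply _ MeasurableSet.univ, ← hc.tsum_eq,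
    ENNReal.ofReal_tsum_of_nonneg hp hc.summable]
  simp

theorem isFiniteMeasure_mixture [∀ i, IsProbabilityMeasure (A i)] (hp : ∀ i, 0 ≤ p i)
    (hs : Summable p) : IsFiniteMeasure (mixture p A) :=
  ⟨by rw [mixture_univ hp hs.hasSum]; exact ENNReal.ofReal_lt_top⟩

theorem isProbabilityMeasure_mixture [∀ i, IsProbabilityMeasure (A i)] (hp : ∀ i, 0 ≤ p i)
    (hs : HasSum p 1) : IsProbabilityMeasure (mixture p A) :=
  ⟨by rw [mixture_univ hp hs, ENNReal.ofReal_one]⟩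

theorem hasSum_charFun_mixture {A : ι → Measure ℝ} [∀ i, IsProbabilityMeasure (A i)]
    (hp : ∀ i, 0 ≤ p i) (hs : Summable p) (u : ℝ) :
    HasSum (fun i => (p i : ℂ) * charFun (A i) u) (charFun (mixture p A) u) := by
  have := isFiniteMeasure_mixture (A := A) hp hs
  have hint : Integrable (fun x : ℝ => Complex.exp (u * x * Complex.I)) (mixture p A) := by
    refine Integrable.of_bound (by fun_prop) 1 (Eventually.of_forall fun x => ?_)
    rw [← Complex.ofReal_mul, Complex.norm_exp_ofReal_mul_I]
  have h := hasSum_integral_measure hint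
  simp_rw [charFun_apply_real]
  refine h.congr_fun fun i => ?_
  rw [integral_smul_measure, ENNReal.toReal_ofReal (hp i), Complex.real_smul]

end Mixture

/-- The convolution of `B` with the compound Poisson distribution with jump measure `ρ`, where `ρ`
is a probability measure. -/
def compound (B ρ : Measure ℝ) : Measure ℝ :=
  mixture (fun N : ℕ => Real.exp (-1) / N.factorial) fun N => B ∗ convPow ρ N

theorem hasSum_poisson_weights (c : ℝ) :
    HasSum (fun N : ℕ => Real.exp (-1) / N.factorial * c ^ N) (Real.exp (c - 1)) := by
  have h := (NormedSpace.expSeries_div_hasSum_exp c).mul_left (Real.exp (-1))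
  rw [← Real.exp_eq_exp_ℝ, ← Real.exp_add, neg_add_eq_sub] at h
  exact h.congr_fun fun i => by ring

variable (B ρ : Measure ℝ) [IsProbabilityMeasure B] [IsProbabilityMeasure ρ]

instance compound.isProbabilityMeasure : IsProbabilityMeasure (compound B ρ) :=
  isProbabilityMeasure_mixture (fun N => by positivity) (by simpa using hasSum_poisson_weights 1)

theorem charFun_compound (u : ℝ) :
    charFun (compound B ρ) u = charFun B u * Complex.exp (charFun ρ u - 1) := by
  have h1 := hasSum_charFun_mixture (A := fun N => B ∗ convPow ρ N)
    (p := fun N : ℕ => Real.exp (-1) / N.factorial) (fun N => by positivity)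
    (by simpa using (hasSum_poisson_weights 1).summable) u
  have h2 := ((NormedSpace.expSeries_div_hasSum_exp (charFun ρ u)).mul_left
    (charFun B u * Complex.exp (-1)))
  rw [← Complex.exp_eq_exp_ℂ, mul_assoc, ← Complex.exp_add, neg_add_eq_sub] at h2
  refine h1.unique (h2.congr_fun fun i => ?_)
  rw [charFun_conv, charFun_convPow]
  push_cast
  ring

variable {B ρ}

/-- The errors `2 ^ N δ` on the `N`-jump components add up to `δ • D`, where `D` is the same Poisson
mixture with weights multiplied by `2 ^ N`. Its squared norm on L² of the mixture is at most the
Poisson mean of `4 ^ N`, which is `e³`. -/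
theorem sqDom_compound {ρ₁ : Measure ℝ} [IsProbabilityMeasure ρ₁] {δ : ℝ≥0∞} (hδ : δ ≠ ∞)
    (hρ : ρ₁ ≤ (2 : ℝ≥0∞) • ρ) (h₁ : B ∗ ρ₁ ≤ B ∗ ρ + δ • (B ∗ ρ))
    (h₂ : B ∗ ρ ≤ B ∗ ρ₁ + δ • (B ∗ ρ)) :
    SqDom (1 + δ ^ 2 * ENNReal.ofReal (Real.exp 3)) (compound B ρ) (compound B ρ₁) := by
  set p : ℕ → ℝ≥0∞ := fun N => ENNReal.ofReal (Real.exp (-1) / N.factorial) with hp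
  set D : Measure ℝ := Measure.sum fun N => (p N * 2 ^ N) • (B ∗ convPow ρ N) with hD
  have hM : ∑' N, p N * ((2 : ℝ≥0∞) ^ N) ^ 2 = ENNReal.ofReal (Real.exp 3) := by
    have h := hasSum_poisson_weights 4
    rw [show (4 : ℝ) - 1 = 3 by norm_num] at h
    rw [← h.tsum_eq, ENNReal.ofReal_tsum_of_nonneg (fun N => by positivity) h.summable]
    congr 1
    ext N
    rw [ENNReal.ofReal_mul (by positivity), ENNReal.ofReal_pow (by norm_num), hp, ← pow_mul,
      mul_comm N 2, pow_mul]
    norm_num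
  have hDdom : SqDom (ENNReal.ofReal (Real.exp 3)) (compound B ρ) D := by
    rw [← hM]
    exact sqDom_sum p (fun N => 2 ^ N) fun N => B ∗ convPow ρ N
  have hle : ∀ N, ((2 ^ N - 1 : ℕ) : ℝ≥0∞) ≤ 2 ^ N := fun N => by
    exact_mod_cast Nat.sub_le _ _
  have hsum : δ • D = Measure.sum fun N => p N • ((2 ^ N * δ) • (B ∗ convPow ρ N)) := by
    rw [hD, smul_sum_measure]
    congr 1
    ext1 N
    rw [smul_smul, smul_smul]
    congr 1; ring
  refine sqDom_of_le_add (D := δ • D) (ENNReal.mul_ne_top (by simpa using hδ) (by simp)) ?_ ?_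
    (hDdom.smul δ)
  · rw [hsum, compound, compound, mixture, mixture, Measure.sum_add_sum]
    refine sum_measure_mono fun N => ?_
    rw [← smul_add]
    gcongr
    refine (convPow_domination hδ hρ h₁ h₂ N).1.trans ?_
    gcongr
    exact hle N
  · rw [hsum, compound, compound, mixture, mixture, Measure.sum_add_sum]
    refine sum_measure_mono fun N => ?_
    rw [← smul_add]
    gcongr
    refine (convPow_domination hδ hρ h₁ h₂ N).2.trans ?_
    gcongr
    exact hle N

end Convolution

/-! ### Oscillating reweightings of Gaussian laws -/

section Tilt

theorem one_add_mul_cos_nonneg {κ : ℝ} (h0 : 0 ≤ κ) (h1 : κ ≤ 1) (y : ℝ) :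
    0 ≤ 1 + κ * Real.cos y := by
  nlinarith [Real.neg_one_le_cos y]

/-- The measure `μ` reweighted by `1 + κ cos (a (x - b))`. -/
def tilt (μ : Measure ℝ) (κ a b : ℝ) : Measure ℝ :=
  μ.withDensity fun x => ENNReal.ofReal (1 + κ * Real.cos (a * (x - b)))

variable {κ : ℝ}

theorem withDensity_ofReal_le (μ : Measure ℝ) {f : ℝ → ℝ} {c : ℝ} (h : ∀ x, f x ≤ c) :
    μ.withDensity (fun x => ENNReal.ofReal (f x)) ≤ ENNReal.ofReal c • μ := by
  rw [← withDensity_const]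
  exact withDensity_mono (Eventually.of_forall fun x => ENNReal.ofReal_le_ofReal (h x))

theorem tilt_le (μ : Measure ℝ) (h0 : 0 ≤ κ) (a b : ℝ) :
    tilt μ κ a b ≤ μ + ENNReal.ofReal κ • μ := by
  refine (withDensity_ofReal_le μ (c := 1 + κ) fun x => ?_).trans ?_
  · nlinarith [Real.cos_le_one (a * (x - b))]
  · rw [ENNReal.ofReal_add zero_le_one h0, add_smul, ENNReal.ofReal_one, one_smul]

theorem le_tilt_add (μ : Measure ℝ) [SFinite μ] (h0 : 0 ≤ κ) (a b : ℝ) :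
    μ ≤ tilt μ κ a b + ENNReal.ofReal κ • μ := by
  have h : μ = μ.withDensity fun _ => ENNReal.ofReal 1 := by simp [withDensity_const]
  rw [← withDensity_const, tilt, ← withDensity_add_left (by fun_prop)]
  conv_lhs => rw [h]
  refine withDensity_mono (Eventually.of_forall fun x => ?_)
  simp only [Pi.add_apply]
  refine le_trans (ENNReal.ofReal_le_ofReal ?_) ENNReal.ofReal_add_le
  nlinarith [Real.neg_one_le_cos (a * (x - b))]

theorem isFiniteMeasure_tilt (μ : Measure ℝ) [IsFiniteMeasure μ] (h0 : 0 ≤ κ) (a b : ℝ) :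
    IsFiniteMeasure (tilt μ κ a b) := by
  have : IsFiniteMeasure (ENNReal.ofReal κ • μ) := μ.smul_finite ENNReal.ofReal_ne_top
  exact isFiniteMeasure_of_le _ (tilt_le μ h0 a b)

theorem integral_tilt {E : Type*} [NormedAddCommGroup E] [NormedSpace ℝ E] (μ : Measure ℝ)
    (h0 : 0 ≤ κ) (h1 : κ ≤ 1) (a b : ℝ) (f : ℝ → E) :
    ∫ x, f x ∂(tilt μ κ a b) = ∫ x, (1 + κ * Real.cos (a * (x - b))) • f x ∂μ := by
  rw [tilt, integral_withDensity_eq_integral_toReal_smul (by fun_prop) (by simp)]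
  simp only [ENNReal.toReal_ofReal (one_add_mul_cos_nonneg h0 h1 _)]

theorem integrable_charFun_integrand (μ : Measure ℝ) [IsFiniteMeasure μ] (u : ℝ) :
    Integrable (fun x : ℝ => Complex.exp (u * x * Complex.I)) μ := by
  refine Integrable.of_bound (by fun_prop) 1 (Eventually.of_forall fun x => ?_)
  rw [← Complex.ofReal_mul, Complex.norm_exp_ofReal_mul_I]

theorem charFun_tilt (μ : Measure ℝ) [IsFiniteMeasure μ] (h0 : 0 ≤ κ) (h1 : κ ≤ 1) (a b u : ℝ) :
    charFun (tilt μ κ a b) u = charFun μ u + κ / 2 *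
      (Complex.exp (-(a * b * Complex.I)) * charFun μ (u + a) +
        Complex.exp (a * b * Complex.I) * charFun μ (u - a)) := by
  simp only [charFun_apply_real]
  rw [integral_tilt μ h0 h1]
  have i0 := integrable_charFun_integrand μ u
  have i1 := (integrable_charFun_integrand μ (u + a)).const_mul (Complex.exp (-(a * b * Complex.I)))
  have i2 := (integrable_charFun_integrand μ (u - a)).const_mul (Complex.exp (a * b * Complex.I))
  have i3 : Integrable (fun x : ℝ => (κ / 2 : ℂ) *
      (Complex.exp (-(a * b * Complex.I)) * Complex.exp ((u + a : ℝ) * x * Complex.I) +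
        Complex.exp (a * b * Complex.I) * Complex.exp ((u - a : ℝ) * x * Complex.I))) μ :=
    (i1.add i2).const_mul _
  rw [← integral_const_mul, ← integral_const_mul, ← integral_add i1 i2, ← integral_const_mul,
    ← integral_add i0 i3]
  refine integral_congr_ae (Eventually.of_forall fun x => ?_)
  have hcos : ((Real.cos (a * (x - b)) : ℝ) : ℂ) =
      (Complex.exp ((a * (x - b)) * Complex.I) + Complex.exp (-(a * (x - b)) * Complex.I)) / 2 := by
    rw [Complex.ofReal_cos, Complex.cos]; push_cast; rfl
  simp only [Complex.real_smul]
  push_cast at hcos ⊢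
  rw [hcos, ← Complex.exp_add, ← Complex.exp_add]
  have e1 : -(a * b * Complex.I) + (u + a) * x * Complex.I =
      a * (x - b) * Complex.I + u * x * Complex.I := by ring
  have e2 : a * b * Complex.I + (u - a) * x * Complex.I =
      -(a * (x - b)) * Complex.I + u * x * Complex.I := by ring
  rw [e1, e2, Complex.exp_add, Complex.exp_add]
  ring

/-- The damping factor of the frequency `U` of a standard Gaussian density under convolution with
a Gaussian distribution of variance `v`. -/
def damping (U v : ℝ) : ℝ := Real.exp (-(U ^ 2 * v / (2 * (v + 1))))

theorem damping_nonneg (U v : ℝ) : 0 ≤ damping U v := (Real.exp_pos _).le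

theorem damping_le_one (U : ℝ) {v : ℝ} (hv : 0 ≤ v) : damping U v ≤ 1 :=
  Real.exp_le_one_iff.2 (neg_nonpos.2 (by positivity))

/-- Reweighting by a cosine shifts the characteristic function by `±U`. Completing the square in `v
u² + (u ± U)²` leaves `(v + 1) (u ± U / (v + 1))²` plus the constant `U² v / (v + 1)`, which is the
damping. The perturbation thus stays a bounded multiple of a density, with the same Gaussian
envelope. -/
theorem gaussianReal_conv_tilt (h0 : 0 ≤ κ) (h1 : κ ≤ 1) (b U : ℝ) (v : ℝ≥0) :
    gaussianReal b v ∗ tilt (gaussianReal 0 1) κ U 0 =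
      tilt (gaussianReal b (v + 1)) (κ * damping U v) (U / (v + 1)) b := by
  have hk0 : 0 ≤ κ * damping U v := mul_nonneg h0 (damping_nonneg _ _)
  have hk1 : κ * damping U v ≤ 1 := mul_le_one₀ h1 (damping_nonneg _ _) (damping_le_one U v.2)
  have f1 := isFiniteMeasure_tilt (gaussianReal 0 1) h0 U 0
  have f2 := isFiniteMeasure_tilt (gaussianReal b (v + 1)) hk0 (U / (v + 1)) b
  refine Measure.ext_of_charFun (funext fun u => ?_)
  rw [charFun_conv, charFun_tilt _ h0 h1, charFun_tilt _ hk0 hk1]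
  simp only [charFun_gaussianReal, damping]
  have hv : (v : ℂ) + 1 ≠ 0 := by
    have : ((v : ℝ) + 1 : ℝ) ≠ 0 := by positivity
    exact_mod_cast this
  push_cast
  simp only [mul_zero, zero_mul, neg_zero, Complex.exp_zero, one_mul]
  have E0 : Complex.exp (u * b * Complex.I - v * u ^ 2 / 2) * Complex.exp (0 - u ^ 2 / 2) =
      Complex.exp (u * b * Complex.I - (v + 1) * u ^ 2 / 2) := by
    rw [← Complex.exp_add]; congr 1; ring
  have E1 : Complex.exp (u * b * Complex.I - v * u ^ 2 / 2) * Complex.exp (0 - (u + U) ^ 2 / 2) =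
      Complex.exp (-(U ^ 2 * v / (2 * (v + 1)))) * (Complex.exp (-(U / (v + 1) * b * Complex.I)) *
        Complex.exp ((u + U / (v + 1)) * b * Complex.I -
          (v + 1) * (u + U / (v + 1)) ^ 2 / 2)) := by
    rw [← Complex.exp_add, ← Complex.exp_add, ← Complex.exp_add]; congr 1; field_simp; ring
  have E2 : Complex.exp (u * b * Complex.I - v * u ^ 2 / 2) * Complex.exp (0 - (u - U) ^ 2 / 2) =
      Complex.exp (-(U ^ 2 * v / (2 * (v + 1)))) * (Complex.exp (U / (v + 1) * b * Complex.I) *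
        Complex.exp ((u - U / (v + 1)) * b * Complex.I -
          (v + 1) * (u - U / (v + 1)) ^ 2 / 2)) := by
    rw [← Complex.exp_add, ← Complex.exp_add, ← Complex.exp_add]; congr 1; field_simp; ring
  linear_combination E0 + (κ / 2 : ℂ) * E1 + (κ / 2 : ℂ) * E2

theorem gaussianReal_zero_conv_one (b : ℝ) (v : ℝ≥0) :
    gaussianReal b v ∗ gaussianReal 0 1 = gaussianReal b (v + 1) := by
  rw [gaussianReal_conv_gaussianReal, add_zero]

theorem sum_conv {ι : Type*} [Countable ι] (μ : ι → Measure ℝ) (ν : Measure ℝ) [SFinite ν] :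
    Measure.sum μ ∗ ν = Measure.sum fun i => μ i ∗ ν := by
  rw [Measure.conv, Measure.prod_sum_left, Measure.map_sum (by fun_prop)]
  rfl

/-- Comparison of centred Gaussian distributions with variances `v ≤ v'`. -/
theorem gaussianReal_le (b : ℝ) {v v' : ℝ≥0} (hv : 0 < v) (hvv' : v ≤ v') :
    gaussianReal b v ≤ ENNReal.ofReal (Real.sqrt (v' / v)) • gaussianReal b v' := by
  have hv' : 0 < v' := hv.trans_le hvv'
  rw [gaussianReal_of_var_ne_zero _ hv.ne', gaussianReal_of_var_ne_zero _ hv'.ne',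
    ← withDensity_smul _ (measurable_gaussianPDF _ _)]
  refine withDensity_mono (Eventually.of_forall fun x => ?_)
  simp only [Pi.smul_apply, smul_eq_mul, gaussianPDF]
  rw [← ENNReal.ofReal_mul (Real.sqrt_nonneg _)]
  refine ENNReal.ofReal_le_ofReal ?_
  simp only [gaussianPDFReal]
  have hvr : (0 : ℝ) < v := hv
  have hvr' : (0 : ℝ) < v' := hv'
  have hle : (v : ℝ) ≤ v' := hvv'
  rw [← mul_assoc]
  have hs : Real.sqrt (v' / v) * (Real.sqrt (2 * Real.pi * v'))⁻¹ =
      (Real.sqrt (2 * Real.pi * v))⁻¹ := by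
    rw [← Real.sqrt_inv, ← Real.sqrt_inv, ← Real.sqrt_mul (by positivity)]
    congr 1
    field_simp
  rw [hs]
  gcongr ?_ * Real.exp ?_
  rw [neg_div, neg_div, neg_le_neg_iff]
  gcongr

end Tilt

/-! ### The perturbed jump law and its damping by a Gaussian mixture -/

section JumpLaw

/-- The law of the perturbed jumps: an equal mixture of the standard Gaussian distribution,
reweighted by `1 + κ cos (U x)`, and an atom at zero (which does not contribute any jumps). -/
def jumpLaw (κ U : ℝ) : Measure ℝ :=
  (2⁻¹ : ℝ≥0∞) • tilt (gaussianReal 0 1) κ U 0 +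
    ENNReal.ofReal ((1 - κ * Real.exp (-(U ^ 2 / 2))) / 2) • Measure.dirac 0

variable {κ U : ℝ}

theorem jumpLaw_atom_nonneg (h1 : κ ≤ 1) (U : ℝ) :
    0 ≤ (1 - κ * Real.exp (-(U ^ 2 / 2))) / 2 := by
  have h2 : Real.exp (-(U ^ 2 / 2)) ≤ 1 := Real.exp_le_one_iff.2 (by nlinarith [sq_nonneg U])
  have := mul_le_one₀ h1 (Real.exp_pos _).le h2
  linarith

theorem isFiniteMeasure_jumpLaw (h0 : 0 ≤ κ) (U : ℝ) : IsFiniteMeasure (jumpLaw κ U) := by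
  have := isFiniteMeasure_tilt (gaussianReal 0 1) h0 U 0
  have i1 : IsFiniteMeasure ((2⁻¹ : ℝ≥0∞) • tilt (gaussianReal 0 1) κ U 0) :=
    Measure.smul_finite _ (by simp)
  have i2 : IsFiniteMeasure (ENNReal.ofReal ((1 - κ * Real.exp (-(U ^ 2 / 2))) / 2) •
      Measure.dirac (0 : ℝ)) := Measure.smul_finite _ ENNReal.ofReal_ne_top
  rw [jumpLaw]; infer_instance

/-- The characteristic function of `jumpLaw`. -/
def jumpCharFun (κ U u : ℝ) : ℝ :=
  (Real.exp (-(u ^ 2 / 2)) + κ / 2 * (Real.exp (-((u + U) ^ 2 / 2)) +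
    Real.exp (-((u - U) ^ 2 / 2)))) / 2 + (1 - κ * Real.exp (-(U ^ 2 / 2))) / 2

theorem charFun_add_measure (μ ν : Measure ℝ) [IsFiniteMeasure μ] [IsFiniteMeasure ν] (u : ℝ) :
    charFun (μ + ν) u = charFun μ u + charFun ν u := by
  simp only [charFun_apply_real]
  exact integral_add_measure (integrable_charFun_integrand μ u) (integrable_charFun_integrand ν u)

theorem charFun_smul_measure (μ : Measure ℝ) (c : ℝ≥0∞) (u : ℝ) :
    charFun (c • μ) u = c.toReal * charFun μ u := by
  simp only [charFun_apply_real]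
  rw [integral_smul_measure, Complex.real_smul]

theorem charFun_jumpLaw (h0 : 0 ≤ κ) (h1 : κ ≤ 1) (U u : ℝ) :
    charFun (jumpLaw κ U) u = jumpCharFun κ U u := by
  have := isFiniteMeasure_tilt (gaussianReal 0 1) h0 U 0
  have i1 : IsFiniteMeasure ((2⁻¹ : ℝ≥0∞) • tilt (gaussianReal 0 1) κ U 0) :=
    Measure.smul_finite _ (by simp)
  have i2 : IsFiniteMeasure (ENNReal.ofReal ((1 - κ * Real.exp (-(U ^ 2 / 2))) / 2) •
      Measure.dirac (0 : ℝ)) := Measure.smul_finite _ ENNReal.ofReal_ne_top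
  rw [jumpLaw, charFun_add_measure, charFun_smul_measure, charFun_smul_measure, charFun_tilt _ h0 h1,
    ENNReal.toReal_ofReal (jumpLaw_atom_nonneg h1 U), jumpCharFun]
  simp only [charFun_gaussianReal, charFun_dirac]
  push_cast
  simp
  ring

theorem isProbabilityMeasure_jumpLaw (h0 : 0 ≤ κ) (h1 : κ ≤ 1) (U : ℝ) :
    IsProbabilityMeasure (jumpLaw κ U) := by
  have := isFiniteMeasure_jumpLaw h0 U
  have h := charFun_jumpLaw h0 h1 U 0
  rw [charFun_zero] at h
  have h2 : (jumpLaw κ U).real Set.univ = 1 := by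
    have : (jumpLaw κ U).real Set.univ = jumpCharFun κ U 0 := by exact_mod_cast h
    rw [this, jumpCharFun]
    simp
    ring
  exact isProbabilityMeasure_iff_real.2 h2

theorem tilt_zero (μ : Measure ℝ) (a b : ℝ) : tilt μ 0 a b = μ := by
  simp [tilt, withDensity_const]

theorem jumpLaw_zero (U : ℝ) :
    jumpLaw 0 U = (2⁻¹ : ℝ≥0∞) • gaussianReal 0 1 + (2⁻¹ : ℝ≥0∞) • Measure.dirac 0 := by
  rw [jumpLaw, tilt_zero]
  simp

/-- The reweighting is at most `1 + κ ≤ 2`, and the atom only loses mass. This domination controls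
the exchange errors in convolution powers. -/
theorem jumpLaw_le (h0 : 0 ≤ κ) (h1 : κ ≤ 1) (U : ℝ) :
    jumpLaw κ U ≤ (2 : ℝ≥0∞) • jumpLaw 0 U := by
  rw [jumpLaw_zero, jumpLaw, smul_add]
  have hk : ENNReal.ofReal κ ≤ 1 := ENNReal.ofReal_le_one.2 h1
  refine add_le_add ?_ ?_
  · rw [smul_smul, mul_comm, ← smul_smul]
    gcongr
    refine (tilt_le _ h0 _ _).trans ?_
    rw [two_smul]
    gcongr
    calc ENNReal.ofReal κ • gaussianReal 0 1 ≤ (1 : ℝ≥0∞) • gaussianReal 0 1 := by gcongr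
      _ = _ := one_smul _ _
  · rw [smul_smul, ENNReal.mul_inv_cancel (by simp) (by simp)]
    gcongr
    rw [ENNReal.ofReal_le_one]
    have := mul_nonneg h0 (Real.exp_pos (-(U ^ 2 / 2))).le
    linarith

theorem mixture_mul_left {ι : Type*} {p : ι → ℝ} (hp : ∀ i, 0 ≤ p i) (c : ι → ℝ) (A : ι → Measure ℝ) :
    mixture (fun i => p i * c i) A =
      Measure.sum fun i => ENNReal.ofReal (p i) • ENNReal.ofReal (c i) • A i := by
  rw [mixture]
  congr 1
  ext1 i
  rw [ENNReal.ofReal_mul (hp i), smul_smul]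

variable {ι : Type*} {p : ι → ℝ} {b : ℝ} {v : ι → ℝ≥0}

/-- If the damped Gaussian mixture is bounded by `δ` times the undamped one, then replacing
`jumpLaw 0 U` by `jumpLaw κ U` changes the convolution with the mixture by the factor `κ δ` only. -/
theorem mixture_conv_jumpLaw [Countable ι] (hp : ∀ i, 0 ≤ p i) (hsum : HasSum p 1) (h0 : 0 ≤ κ) (h1 : κ ≤ 1)
    {δ : ℝ} (hδ : Real.exp (-(U ^ 2 / 2)) ≤ δ)
    (hE : mixture (fun i => p i * damping U (v i)) (fun i => gaussianReal b (v i + 1)) ≤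
      ENNReal.ofReal δ • mixture p fun i => gaussianReal b (v i + 1)) :
    mixture p (fun i => gaussianReal b (v i)) ∗ jumpLaw κ U ≤
      mixture p (fun i => gaussianReal b (v i)) ∗ jumpLaw 0 U +
        ENNReal.ofReal (κ * δ) • (mixture p (fun i => gaussianReal b (v i)) ∗ jumpLaw 0 U) ∧
    mixture p (fun i => gaussianReal b (v i)) ∗ jumpLaw 0 U ≤
      mixture p (fun i => gaussianReal b (v i)) ∗ jumpLaw κ U +
        ENNReal.ofReal (κ * δ) • (mixture p (fun i => gaussianReal b (v i)) ∗ jumpLaw 0 U) := by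
  set B := mixture p fun i => gaussianReal b (v i) with hB
  set G := mixture p fun i => gaussianReal b (v i + 1) with hG
  set E := mixture (fun i => p i * damping U (v i)) (fun i => gaussianReal b (v i + 1))
  have hBp : IsProbabilityMeasure B := isProbabilityMeasure_mixture hp hsum
  have hδ0 : 0 ≤ δ := (Real.exp_pos _).le.trans hδ
  have ft := isFiniteMeasure_tilt (gaussianReal 0 1) h0 U 0
  have hconv : ∀ (ν : Measure ℝ), SFinite ν →
      B ∗ ν = Measure.sum fun i => ENNReal.ofReal (p i) • (gaussianReal b (v i) ∗ ν) := by
    intro ν _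
    rw [hB, mixture, sum_conv]
    simp only [Measure.conv_smul_left]
  have hBG : B ∗ gaussianReal 0 1 = G := by
    rw [hconv _ inferInstance]
    simp only [gaussianReal_zero_conv_one]
    rfl
  have hBT : B ∗ tilt (gaussianReal 0 1) κ U 0 = Measure.sum fun i => ENNReal.ofReal (p i) •
      tilt (gaussianReal b (v i + 1)) (κ * damping U (v i)) (U / (v i + 1)) b := by
    rw [hconv _ inferInstance]
    simp only [gaussianReal_conv_tilt h0 h1]
  have hEsum : ENNReal.ofReal κ • E = Measure.sum fun i => ENNReal.ofReal (p i) •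
      ENNReal.ofReal (κ * damping U (v i)) • gaussianReal b (v i + 1) := by
    rw [show E = _ from mixture_mul_left hp _ _, smul_sum_measure]
    congr 1
    ext1 i
    rw [ENNReal.ofReal_mul h0, smul_smul, smul_smul, smul_smul]
    congr 1
    ring
  have hle1 : B ∗ tilt (gaussianReal 0 1) κ U 0 ≤ G + ENNReal.ofReal κ • E := by
    rw [hBT, hEsum, hG, mixture, Measure.sum_add_sum]
    refine sum_measure_mono fun i => ?_
    rw [← smul_add]
    gcongr
    exact tilt_le _ (mul_nonneg h0 (damping_nonneg _ _)) _ _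
  have hle2 : G ≤ B ∗ tilt (gaussianReal 0 1) κ U 0 + ENNReal.ofReal κ • E := by
    rw [hBT, hEsum, hG, mixture, Measure.sum_add_sum]
    refine sum_measure_mono fun i => ?_
    rw [← smul_add]
    gcongr
    exact le_tilt_add _ (mul_nonneg h0 (damping_nonneg _ _)) _ _
  have hkE : ENNReal.ofReal κ • E ≤ ENNReal.ofReal (κ * δ) • G := by
    rw [ENNReal.ofReal_mul h0, ← smul_smul]
    gcongr
  have hsplit : ∀ (μ : Measure ℝ) (c : ℝ≥0∞), IsFiniteMeasure μ → c ≠ ∞ →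
      B ∗ ((2⁻¹ : ℝ≥0∞) • μ + c • Measure.dirac 0) = (2⁻¹ : ℝ≥0∞) • (B ∗ μ) + c • B := by
    intro μ c _ hc
    have i1 : IsFiniteMeasure ((2⁻¹ : ℝ≥0∞) • μ) := Measure.smul_finite _ (by simp)
    have i2 : IsFiniteMeasure (c • Measure.dirac (0 : ℝ)) := Measure.smul_finite _ hc
    rw [Measure.conv_add, Measure.conv_smul_right, Measure.conv_smul_right, Measure.conv_dirac_zero]
  have hB0 : B ∗ jumpLaw 0 U = (2⁻¹ : ℝ≥0∞) • G + (2⁻¹ : ℝ≥0∞) • B := by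
    rw [jumpLaw_zero, hsplit _ _ inferInstance (by simp), hBG]
  have hB1 : B ∗ jumpLaw κ U = (2⁻¹ : ℝ≥0∞) • (B ∗ tilt (gaussianReal 0 1) κ U 0) +
      ENNReal.ofReal ((1 - κ * Real.exp (-(U ^ 2 / 2))) / 2) • B := by
    rw [jumpLaw, hsplit _ _ inferInstance ENNReal.ofReal_ne_top]
  have hhalf : (2⁻¹ : ℝ≥0∞) = ENNReal.ofReal (1 / 2) := by
    rw [one_div, ENNReal.ofReal_inv_of_pos two_pos]; simp
  have hm0 := mul_nonneg h0 (Real.exp_pos (-(U ^ 2 / 2))).le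
  have hmδ : κ * Real.exp (-(U ^ 2 / 2)) ≤ κ * δ := by gcongr
  rw [hB0, hB1]
  constructor
  · calc _ ≤ (2⁻¹ : ℝ≥0∞) • (G + ENNReal.ofReal (κ * δ) • G) + (2⁻¹ : ℝ≥0∞) • B := by
          gcongr
          · exact hle1.trans (by gcongr)
          · rw [hhalf]
            exact ENNReal.ofReal_le_ofReal (by linarith)
      _ ≤ ((2⁻¹ : ℝ≥0∞) • (G + ENNReal.ofReal (κ * δ) • G) + (2⁻¹ : ℝ≥0∞) • B) +
          ENNReal.ofReal (κ * δ) • (2⁻¹ : ℝ≥0∞) • B := Measure.le_add_right le_rfl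
      _ = _ := by module
  · have hsp : (2⁻¹ : ℝ≥0∞) ≤ ENNReal.ofReal ((1 - κ * Real.exp (-(U ^ 2 / 2))) / 2) +
        ENNReal.ofReal (κ * δ) * 2⁻¹ := by
      rw [hhalf, ← ENNReal.ofReal_mul (mul_nonneg h0 hδ0),
        ← ENNReal.ofReal_add (jumpLaw_atom_nonneg h1 U) (by positivity)]
      exact ENNReal.ofReal_le_ofReal (by linarith)
    calc (2⁻¹ : ℝ≥0∞) • G + (2⁻¹ : ℝ≥0∞) • B
        ≤ (2⁻¹ : ℝ≥0∞) • (B ∗ tilt (gaussianReal 0 1) κ U 0 + ENNReal.ofReal (κ * δ) • G) +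
          (ENNReal.ofReal ((1 - κ * Real.exp (-(U ^ 2 / 2))) / 2) +
            ENNReal.ofReal (κ * δ) * 2⁻¹) • B := by
          gcongr
          exact hle2.trans (by gcongr)
      _ = _ := by module

/-- The damping of Gaussian distributions of small and of large variance. -/
theorem damping_smul_gaussianReal_le (b U : ℝ) (v : ℝ≥0) :
    ENNReal.ofReal (damping U v) • gaussianReal b (v + 1) ≤
      ENNReal.ofReal (2 * Real.exp (-(U ^ 2 / 4) * v)) • gaussianReal b 2 +
        ENNReal.ofReal (Real.exp (-(U ^ 2 / 4))) • gaussianReal b (v + 1) := by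
  have hv0 : (0 : ℝ) ≤ v := v.2
  -- For `v ≤ 1` the Gaussian law is compared with the one of variance `2`, and `v + 1 ≤ 2` bounds
  -- the damping by `e ^ (-U² v / 4)`. For `v ≥ 1` the damping alone is at most `e ^ (-U² / 4)`.
  rcases le_total v 1 with hv | hv
  · refine le_trans ?_ (Measure.le_add_right le_rfl)
    have hv1 : (v : ℝ) ≤ 1 := hv
    have hg := gaussianReal_le b (v := v + 1) (v' := 2) (by positivity)
      (by rw [← one_add_one_eq_two]; gcongr)
    calc _ ≤ ENNReal.ofReal (damping U v) •
          (ENNReal.ofReal (Real.sqrt ((2 : ℝ≥0) / (v + 1 : ℝ≥0))) • gaussianReal b 2) := by gcongr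
      _ ≤ _ := by
        rw [smul_smul, ← ENNReal.ofReal_mul (damping_nonneg _ _), mul_comm]
        gcongr
        · exact damping_nonneg _ _
        · rw [Real.sqrt_le_left (by norm_num), div_le_iff₀ (by positivity)]
          push_cast
          nlinarith
        · rw [damping, Real.exp_le_exp, neg_mul, neg_le_neg_iff, le_div_iff₀ (by positivity)]
          nlinarith [mul_nonneg (mul_nonneg (sq_nonneg U) hv0) (sub_nonneg.2 hv1)]
  · refine le_trans ?_ (Measure.le_add_left le_rfl)
    have hv1 : (1 : ℝ) ≤ v := hv
    gcongr
    rw [damping, Real.exp_le_exp, neg_le_neg_iff, le_div_iff₀ (by positivity)]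
    nlinarith [mul_nonneg (sq_nonneg U) (sub_nonneg.2 hv1)]

/-- Small variances are all charged to the single Gaussian law of variance `2`, so their total is
governed by the Laplace transform `S` of the random variance. The lower bound `hG` converts this
back into a multiple of the mixture. -/
theorem mixture_damping_le (hp : ∀ i, 0 ≤ p i) {U S c : ℝ} (hc : 0 < c)
    (hS : HasSum (fun i => p i * Real.exp (-(U ^ 2 / 4) * v i)) S)
    (hG : ENNReal.ofReal c • gaussianReal b 2 ≤ mixture p fun i => gaussianReal b (v i + 1)) :
    mixture (fun i => p i * damping U (v i)) (fun i => gaussianReal b (v i + 1)) ≤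
      ENNReal.ofReal (2 * S / c + Real.exp (-(U ^ 2 / 4))) •
        mixture p fun i => gaussianReal b (v i + 1) := by
  have hterm : ∀ i, 0 ≤ p i * Real.exp (-(U ^ 2 / 4) * v i) := fun i =>
    mul_nonneg (hp i) (Real.exp_pos _).le
  have hS0 : 0 ≤ S := hS.nonneg hterm
  set G := mixture p fun i => gaussianReal b (v i + 1) with hGdef
  have hfirst : Measure.sum (fun i => ENNReal.ofReal (p i) •
      ENNReal.ofReal (2 * Real.exp (-(U ^ 2 / 4) * v i)) • gaussianReal b 2) =
      ENNReal.ofReal (2 * S) • gaussianReal b 2 := by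
    ext s hs
    have h2 := hS.mul_left 2
    rw [Measure.sum_apply _ hs, ← h2.tsum_eq,
      Measure.smul_apply, smul_eq_mul,
      ENNReal.ofReal_tsum_of_nonneg (fun i => mul_nonneg zero_le_two (hterm i)) h2.summable,
      ← ENNReal.tsum_mul_right]
    congr 1
    ext1 i
    rw [Measure.smul_apply, Measure.smul_apply, smul_eq_mul, smul_eq_mul, ← mul_assoc,
      ← ENNReal.ofReal_mul (hp i)]
    congr 2
    ring
  calc mixture (fun i => p i * damping U (v i)) (fun i => gaussianReal b (v i + 1))
      = Measure.sum fun i => ENNReal.ofReal (p i) • ENNReal.ofReal (damping U (v i)) •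
          gaussianReal b (v i + 1) := mixture_mul_left hp _ _
    _ ≤ Measure.sum fun i => ENNReal.ofReal (p i) •
          (ENNReal.ofReal (2 * Real.exp (-(U ^ 2 / 4) * v i)) • gaussianReal b 2 +
            ENNReal.ofReal (Real.exp (-(U ^ 2 / 4))) • gaussianReal b (v i + 1)) :=
        sum_measure_mono fun i => by gcongr; exact damping_smul_gaussianReal_le b U (v i)
    _ = ENNReal.ofReal (2 * S) • gaussianReal b 2 + ENNReal.ofReal (Real.exp (-(U ^ 2 / 4))) • G := by
        simp only [smul_add]
        rw [← Measure.sum_add_sum, hfirst, hGdef, mixture, smul_sum_measure]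
        congr 2
        ext1 i
        rw [smul_comm]
    _ ≤ ENNReal.ofReal (2 * S / c) • G + ENNReal.ofReal (Real.exp (-(U ^ 2 / 4))) • G := by
        refine add_le_add ?_ le_rfl
        calc ENNReal.ofReal (2 * S) • gaussianReal b 2
            = ENNReal.ofReal (2 * S / c) • (ENNReal.ofReal c • gaussianReal b 2) := by
              rw [smul_smul, ← ENNReal.ofReal_mul (by positivity), div_mul_cancel₀ _ hc.ne']
          _ ≤ _ := by gcongr
    _ = _ := by rw [← add_smul, ENNReal.ofReal_add (by positivity) (Real.exp_pos _).le]

end JumpLaw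

/-! ### The base law: Gaussian mixtures with compound Poisson variance -/

section Base

/-- The exponent `∑ a_k (z ^ k - 1)` of the generating function of a compound Poisson distribution
on the natural numbers. -/
def genExponent (a : ℕ → ℝ) (z : ℝ) : ℝ := ∑' k, a k * (z ^ k - 1)

/-- `w` are the weights of the compound Poisson distribution on the natural numbers with jump
intensities `a`, which has finite mean. -/
structure IsCompoundWeights (w a : ℕ → ℝ) : Prop where
  w_nonneg : ∀ k, 0 ≤ w k
  a_nonneg : ∀ k, 0 ≤ a k
  summable_a : Summable a
  summable_mean : Summable fun k => a k * k
  hasSum_w : ∀ z : ℝ, 0 ≤ z → z ≤ 1 → HasSum (fun k => w k * z ^ k) (Real.exp (genExponent a z))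

/-- The weights of the base law. -/
def baseWeight (w : ℕ → ℝ) (i : ℕ × ℕ) : ℝ := w i.1 * (Real.exp (-1) / i.2.factorial)

/-- The variances of the base law. -/
def baseVar (σ2 τ2 : ℝ≥0) (i : ℕ × ℕ) : ℝ≥0 := σ2 + i.1 * τ2 + i.2

/-- The Gaussian mixture with mean `b` and random variance `σ2 + τ2 M + N`, where `M` is compound
Poisson with weights `w` and `N` is an independent Poisson variable. -/
def baseLaw (w : ℕ → ℝ) (σ2 τ2 : ℝ≥0) (b : ℝ) : Measure ℝ :=
  mixture (baseWeight w) fun i => gaussianReal b (baseVar σ2 τ2 i)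

variable {w a : ℕ → ℝ}

theorem baseWeight_nonneg (h : IsCompoundWeights w a) (i : ℕ × ℕ) : 0 ≤ baseWeight w i :=
  mul_nonneg (h.w_nonneg _) (by positivity)

/-- The Laplace transform of the random variance factorises over its independent parts. At `θ = u² /
2` it gives the characteristic function of the base law, at `θ = U² / 4` the damping, at `θ = 0` the
total mass. -/
theorem hasSum_baseWeight_mul_exp (h : IsCompoundWeights w a) (σ2 τ2 : ℝ≥0) {θ : ℝ} (hθ : 0 ≤ θ) :
    HasSum (fun i => baseWeight w i * Real.exp (-θ * baseVar σ2 τ2 i))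
      (Real.exp (-θ * σ2 + genExponent a (Real.exp (-θ * τ2)) + (Real.exp (-θ) - 1))) := by
  have hz1 : Real.exp (-θ * τ2) ≤ 1 := Real.exp_le_one_iff.2 (by
    rw [neg_mul]; exact neg_nonpos.2 (mul_nonneg hθ τ2.2))
  have h1 := h.hasSum_w _ (Real.exp_pos (-θ * τ2)).le hz1
  have h2 := hasSum_poisson_weights (Real.exp (-θ))
  have h3 := (h1.mul h2 (h1.summable.mul_of_nonneg h2.summable
    (fun k => mul_nonneg (h.w_nonneg k) (pow_nonneg (Real.exp_pos _).le _))
    (fun k => by positivity))).mul_left (Real.exp (-θ * σ2))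
  rw [← Real.exp_add, ← Real.exp_add, ← add_assoc] at h3
  refine h3.congr_fun fun i => ?_
  rw [baseWeight, baseVar, ← Real.exp_nat_mul, ← Real.exp_nat_mul]
  push_cast
  rw [show -θ * ((σ2 : ℝ) + i.1 * τ2 + i.2) = -θ * σ2 + (i.1 * (-θ * τ2) + i.2 * -θ) by ring,
    Real.exp_add, Real.exp_add]
  ring

theorem genExponent_one (a : ℕ → ℝ) : genExponent a 1 = 0 := by simp [genExponent]

theorem hasSum_baseWeight (h : IsCompoundWeights w a) : HasSum (baseWeight w) 1 := by
  have := hasSum_baseWeight_mul_exp h 0 0 le_rfl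
  simpa [genExponent_one a] using this

theorem isProbabilityMeasure_baseLaw (h : IsCompoundWeights w a) (σ2 τ2 : ℝ≥0) (b : ℝ) : IsProbabilityMeasure (baseLaw w σ2 τ2 b) :=
  isProbabilityMeasure_mixture (baseWeight_nonneg h) (hasSum_baseWeight h)

theorem charFun_baseLaw (h : IsCompoundWeights w a) (σ2 τ2 : ℝ≥0) (b u : ℝ) :
    charFun (baseLaw w σ2 τ2 b) u = Complex.exp (Complex.I * u * b + ((-(u ^ 2 / 2) * σ2 +
      genExponent a (Real.exp (-(u ^ 2 / 2) * τ2)) + (Real.exp (-(u ^ 2 / 2)) - 1) : ℝ) : ℂ)) := by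
  have h1 := hasSum_charFun_mixture (A := fun i => gaussianReal b (baseVar σ2 τ2 i))
    (baseWeight_nonneg h) (hasSum_baseWeight h).summable u
  have h2 := (Complex.hasSum_ofReal.2 (hasSum_baseWeight_mul_exp h σ2 τ2
    (θ := u ^ 2 / 2) (by positivity))).mul_left (Complex.exp (Complex.I * u * b))
  rw [Complex.ofReal_exp, ← Complex.exp_add] at h2
  refine h1.unique (h2.congr_fun fun i => ?_)
  rw [charFun_gaussianReal]
  push_cast
  rw [mul_left_comm, ← Complex.exp_add]
  congr 2
  ring

/-- The event that the Poisson part equals one makes every remaining variance at least `2`.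
Spreading from `2` to `2 + k τ2` costs `√(1 + k τ2 / 2) ≤ e ^ (k τ2 / 4)`, so the surviving mass is
a value of the generating function of `w`. -/
theorem le_mixture_baseVar_add_one (h : IsCompoundWeights w a) (τ2 : ℝ≥0) (b : ℝ) :
    ENNReal.ofReal (Real.exp (genExponent a (Real.exp (-(1 / 4) * τ2)) - 1)) • gaussianReal b 2 ≤
      mixture (baseWeight w) fun i => gaussianReal b (baseVar 0 τ2 i + 1) := by
  have hz1 : Real.exp (-(1 / 4) * τ2) ≤ 1 := Real.exp_le_one_iff.2 (by
    rw [neg_mul]; exact neg_nonpos.2 (mul_nonneg (by norm_num) τ2.2))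
  have h1 := (h.hasSum_w _ (Real.exp_pos (-(1 / 4) * τ2)).le hz1).mul_left (Real.exp (-1))
  rw [← Real.exp_add, neg_add_eq_sub] at h1
  refine Measure.le_iff.2 fun s hs => ?_
  rw [mixture, Measure.sum_apply _ hs, Measure.smul_apply, smul_eq_mul, ← h1.tsum_eq,
    ENNReal.ofReal_tsum_of_nonneg (fun k => mul_nonneg (Real.exp_pos _).le
      (mul_nonneg (h.w_nonneg k) (pow_nonneg (Real.exp_pos _).le _))) h1.summable,
    ← ENNReal.tsum_mul_right]
  -- Only the indices `(k, 1)` are kept.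
  refine le_trans (ENNReal.tsum_le_tsum fun k => ?_)
    (ENNReal.tsum_comp_le_tsum_of_injective (f := fun k : ℕ => (k, 1))
      (fun k l hkl => by simpa using hkl) _)
  rw [Measure.smul_apply, smul_eq_mul]
  have hx : (0 : ℝ) ≤ k * τ2 := mul_nonneg k.cast_nonneg τ2.2
  have hvar : baseVar 0 τ2 (k, 1) + 1 = 2 + k * τ2 := by
    rw [baseVar]; push_cast; ring
  have hg := gaussianReal_le b (v := 2) (v' := 2 + k * τ2) two_pos (by simp) s
  rw [Measure.smul_apply, smul_eq_mul] at hg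
  have hsq : Real.exp (-(1 / 4) * τ2) ^ k * Real.sqrt ((2 + k * τ2 : ℝ≥0) / (2 : ℝ≥0)) ≤ 1 := by
    rw [← Real.exp_nat_mul]
    have : Real.sqrt ((2 + k * τ2 : ℝ≥0) / (2 : ℝ≥0)) ≤ Real.exp (k * (1 / 4 * τ2)) := by
      refine Real.sqrt_le_iff.2 ⟨(Real.exp_pos _).le, ?_⟩
      rw [← Real.exp_nat_mul]
      push_cast
      have := Real.add_one_le_exp (2 * (k * (1 / 4 * τ2) : ℝ))
      linarith
    calc _ ≤ Real.exp (k * (-(1 / 4) * τ2)) * Real.exp (k * (1 / 4 * τ2)) := by gcongr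
      _ = 1 := by rw [← Real.exp_add]; simp
  rw [hvar, baseWeight]
  calc ENNReal.ofReal (Real.exp (-1) * (w k * Real.exp (-(1 / 4) * τ2) ^ k)) * gaussianReal b 2 s
      ≤ ENNReal.ofReal (Real.exp (-1) * (w k * Real.exp (-(1 / 4) * τ2) ^ k)) *
        (ENNReal.ofReal (Real.sqrt ((2 + k * τ2 : ℝ≥0) / (2 : ℝ≥0))) *
          gaussianReal b (2 + k * τ2) s) := by gcongr
    _ = ENNReal.ofReal ((w k * Real.exp (-1)) * (Real.exp (-(1 / 4) * τ2) ^ k *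
          Real.sqrt ((2 + k * τ2 : ℝ≥0) / (2 : ℝ≥0)))) * gaussianReal b (2 + k * τ2) s := by
        have := h.w_nonneg k
        rw [← mul_assoc, ← ENNReal.ofReal_mul (by positivity)]
        congr 2
        ring
    _ ≤ _ := by
        gcongr ENNReal.ofReal ?_ * _
        refine (mul_le_of_le_one_right
          (mul_nonneg (h.w_nonneg k) (Real.exp_pos (-1)).le) hsq).trans ?_
        simp

end Base

/-! ### The associated Lévy measures and their characteristic functions -/

section LevyMeasure

/-- The jump measure of the two competing models. -/
def jumpMeasure (a : ℕ → ℝ) (τ2 : ℝ≥0) (κ U : ℝ) : Measure ℝ :=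
  mixture a (fun k => gaussianReal 0 (k * τ2)) + gaussianReal 0 1 + jumpLaw κ U

/-- The measure `σ² δ₀(dx) + x² J(dx)`. -/
def levyMeasure (σ2 : ℝ≥0) (J : Measure ℝ) : Measure ℝ :=
  (σ2 : ℝ≥0∞) • Measure.dirac 0 + J.withDensity fun x => ENNReal.ofReal (x ^ 2)

theorem levyMeasure_singleton_zero (σ2 : ℝ≥0) (J : Measure ℝ) : levyMeasure σ2 J {0} = σ2 := by
  rw [levyMeasure, Measure.add_apply, withDensity_apply _ (measurableSet_singleton 0),
    Measure.restrict_singleton]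
  simp

theorem levyMeasure_univ (σ2 : ℝ≥0) (J : Measure ℝ) :
    levyMeasure σ2 J Set.univ = σ2 + ∫⁻ x, ENNReal.ofReal (x ^ 2) ∂J := by
  simp [levyMeasure]

theorem isFiniteMeasure_levyMeasure (σ2 : ℝ≥0) {J : Measure ℝ}
    (hJ : ∫⁻ x, ENNReal.ofReal (x ^ 2) ∂J ≠ ∞) : IsFiniteMeasure (levyMeasure σ2 J) :=
  ⟨by rw [levyMeasure_univ]; exact ENNReal.add_lt_top.2 ⟨ENNReal.coe_lt_top, hJ.lt_top⟩⟩

theorem integrable_sq_of_lintegral_ne_top {J : Measure ℝ}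
    (hJ : ∫⁻ x, ENNReal.ofReal (x ^ 2) ∂J ≠ ∞) : Integrable (fun x : ℝ => x ^ 2) J := by
  refine ⟨by fun_prop, ?_⟩
  rw [hasFiniteIntegral_iff_ofReal (Eventually.of_forall fun x => sq_nonneg _)]
  exact hJ.lt_top

theorem integrable_id_of_lintegral_sq_ne_top {J : Measure ℝ} [IsFiniteMeasure J]
    (hJ : ∫⁻ x, ENNReal.ofReal (x ^ 2) ∂J ≠ ∞) : Integrable (fun x : ℝ => x) J := by
  refine Integrable.mono' ((integrable_const (1 : ℝ)).add (integrable_sq_of_lintegral_ne_top hJ))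
    (by fun_prop) (Eventually.of_forall fun x => ?_)
  simp only [Pi.add_apply, Real.norm_eq_abs]
  nlinarith [sq_abs x, sq_nonneg (|x| - 1)]

/-- An even characteristic function forces invariance under reflection. The vanishing mean removes
the compensator `-iux`, so that `b` stays the drift of both hypotheses. -/
theorem integral_id_eq_zero_of_charFun_even {J : Measure ℝ} [IsFiniteMeasure J]
    (heven : ∀ u, charFun J (-u) = charFun J u) : ∫ x, x ∂J = 0 := by
  have hmap : J.map (fun x => -x) = J := by
    have : IsFiniteMeasure (J.map fun x => -x) := inferInstance
    refine Measure.ext_of_charFun (funext fun u => ?_)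
    have h := charFun_map_mul (μ := J) (-1) u
    simp only [neg_mul, one_mul] at h
    rw [← heven u]
    exact h
  have h2 : ∫ x, x ∂J = -∫ x, x ∂J := by
    conv_lhs => rw [← hmap]
    rw [integral_map (by fun_prop) (by fun_prop), integral_neg]
  linarith

/-- The Lévy-Khintchine exponent for a finite jump measure with even characteristic function. -/
theorem levyExponent_levyMeasure {σ2 : ℝ≥0} {J : Measure ℝ} [IsFiniteMeasure J]
    (hJ : ∫⁻ x, ENNReal.ofReal (x ^ 2) ∂J ≠ ∞) (heven : ∀ u, charFun J (-u) = charFun J u)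
    {ν : FiniteMeasure ℝ} (hν : (ν : Measure ℝ) = levyMeasure σ2 J) (b u : ℝ) :
    levyExponent b ν u =
      Complex.I * u * b - σ2 * u ^ 2 / 2 + (charFun J u - charFun J 0) := by
  have hx := integrable_id_of_lintegral_sq_ne_top hJ
  have hxC : Integrable (fun x : ℝ => (x : ℂ)) J := hx.ofReal
  have hmean : ∫ x : ℝ, (x : ℂ) ∂J = 0 := by
    rw [integral_complex_ofReal, integral_id_eq_zero_of_charFun_even heven]; simp
  have hk : ∀ x : ℝ, (ENNReal.ofReal (x ^ 2)).toReal • levyKernel u x =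
      Complex.exp (u * x * Complex.I) - 1 - Complex.I * u * x := by
    intro x
    rw [ENNReal.toReal_ofReal (sq_nonneg x), levyKernel, Complex.real_smul]
    split_ifs with h0
    · simp [h0]
    · have : (x : ℂ) ≠ 0 := by exact_mod_cast h0
      push_cast
      field_simp
  have i1 := integrable_charFun_integrand J u
  have i2 : Integrable (fun x : ℝ => Complex.exp (u * x * Complex.I) - 1) J :=
    i1.sub (integrable_const _)
  have i3 : Integrable (fun x : ℝ => Complex.I * u * x) J := hxC.const_mul _
  have iw : Integrable (levyKernel u) (J.withDensity fun x => ENNReal.ofReal (x ^ 2)) := by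
    rw [integrable_withDensity_iff_integrable_smul' (by fun_prop) (by simp)]
    simp only [hk]
    exact i2.sub i3
  have id0 : Integrable (levyKernel u) ((σ2 : ℝ≥0∞) • Measure.dirac 0) :=
    (integrable_dirac (by simp)).smul_measure ENNReal.coe_ne_top
  have e1 : ∫ x, levyKernel u x ∂(J.withDensity fun x => ENNReal.ofReal (x ^ 2)) =
      charFun J u - charFun J 0 := by
    rw [integral_withDensity_eq_integral_toReal_smul (by fun_prop) (by simp)]
    simp only [hk]
    rw [integral_sub i2 i3, integral_sub i1 (integrable_const _), integral_const_mul, hmean,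
      mul_zero, sub_zero, charFun_apply_real, charFun_zero]
    simp
  rw [levyExponent, hν, levyMeasure, integral_add_measure id0 iw, e1, integral_smul_measure,
    integral_dirac, levyKernel]
  simp
  ring

theorem lintegral_sq_gaussianReal (v : ℝ≥0) :
    ∫⁻ x, ENNReal.ofReal (x ^ 2) ∂(gaussianReal 0 v) = v := by
  have h1 : Integrable (fun x : ℝ => x ^ 2) (gaussianReal 0 v) :=
    (memLp_two_iff_integrable_sq (by fun_prop)).1 (memLp_id_gaussianReal (μ := 0) (v := v) 2)
  rw [← ofReal_integral_eq_lintegral_ofReal h1 (Eventually.of_forall fun x => sq_nonneg _)]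
  have h2 := variance_fun_id_gaussianReal (μ := 0) (v := v)
  rw [variance_eq_integral (by fun_prop)] at h2
  simp only [integral_id_gaussianReal, sub_zero] at h2
  rw [h2]
  simp

variable {w a : ℕ → ℝ} {σ2 τ2 : ℝ≥0} {κ U : ℝ}

theorem isFiniteMeasure_jumpMeasure (h : IsCompoundWeights w a) (h0 : 0 ≤ κ) :
    IsFiniteMeasure (jumpMeasure a τ2 κ U) := by
  have i1 := isFiniteMeasure_jumpLaw h0 U
  have i2 := isFiniteMeasure_mixture (A := fun k : ℕ => gaussianReal 0 (k * τ2)) h.a_nonneg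
    h.summable_a
  rw [jumpMeasure]
  infer_instance

theorem charFun_jumpMeasure_sub (h : IsCompoundWeights w a) (h0 : 0 ≤ κ) (h1 : κ ≤ 1) (u : ℝ) :
    charFun (jumpMeasure a τ2 κ U) u - charFun (jumpMeasure a τ2 κ U) 0 =
      ((genExponent a (Real.exp (-(u ^ 2 / 2) * τ2)) + (Real.exp (-(u ^ 2 / 2)) - 1) +
        (jumpCharFun κ U u - 1) : ℝ) : ℂ) := by
  have i1 := isProbabilityMeasure_jumpLaw h0 h1 U
  have i2 := isFiniteMeasure_mixture (A := fun k : ℕ => gaussianReal 0 (k * τ2)) h.a_nonneg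
    h.summable_a
  have hmix : ∀ u, charFun (mixture a fun k : ℕ => gaussianReal 0 (k * τ2)) u =
      ((∑' k, a k * Real.exp (-(u ^ 2 / 2) * τ2) ^ k : ℝ) : ℂ) := by
    intro u
    rw [Complex.ofReal_tsum, ← (hasSum_charFun_mixture h.a_nonneg h.summable_a u).tsum_eq]
    congr 1
    ext1 k
    rw [charFun_gaussianReal, ← Real.exp_nat_mul]
    push_cast
    congr 2
    ring
  have hz : ∀ u : ℝ, Summable fun k => a k * Real.exp (-(u ^ 2 / 2) * τ2) ^ k := by
    intro u
    refine h.summable_a.of_nonneg_of_le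
      (fun k => mul_nonneg (h.a_nonneg k) (pow_nonneg (Real.exp_pos _).le _)) fun k => ?_
    refine mul_le_of_le_one_right (h.a_nonneg k) (pow_le_one₀ (Real.exp_pos _).le ?_)
    refine Real.exp_le_one_iff.2 ?_
    rw [neg_mul]
    exact neg_nonpos.2 (mul_nonneg (by positivity) τ2.2)
  have hgen : genExponent a (Real.exp (-(u ^ 2 / 2) * τ2)) =
      ∑' k, a k * Real.exp (-(u ^ 2 / 2) * τ2) ^ k -
        ∑' k, a k * Real.exp (-((0 : ℝ) ^ 2 / 2) * τ2) ^ k := by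
    rw [← (hz u).tsum_sub (hz 0), genExponent]
    congr 1
    ext1 k
    simp
    ring
  have hone : charFun (jumpLaw κ U) 0 = 1 := by simp [charFun_zero]
  rw [jumpMeasure, charFun_add_measure, charFun_add_measure, charFun_add_measure,
    charFun_add_measure, hmix, hmix, hgen, hone, charFun_jumpLaw h0 h1, charFun_gaussianReal,
    charFun_gaussianReal]
  push_cast
  simp
  ring

theorem jumpCharFun_neg (κ U u : ℝ) : jumpCharFun κ U (-u) = jumpCharFun κ U u := by
  rw [jumpCharFun, jumpCharFun, show (-u + U) ^ 2 = (u - U) ^ 2 by ring,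
    show (-u - U) ^ 2 = (u + U) ^ 2 by ring, neg_sq]
  ring

theorem lintegral_sq_jumpLaw_le (h0 : 0 ≤ κ) (h1 : κ ≤ 1) :
    ∫⁻ x, ENNReal.ofReal (x ^ 2) ∂(jumpLaw κ U) ≤ 1 := by
  refine (lintegral_mono' (jumpLaw_le h0 h1 U) le_rfl).trans ?_
  rw [jumpLaw_zero, lintegral_smul_measure, lintegral_add_measure, lintegral_smul_measure,
    lintegral_smul_measure, lintegral_sq_gaussianReal, lintegral_dirac]
  simp [ENNReal.mul_inv_cancel]

theorem lintegral_sq_jumpMeasure_le (h : IsCompoundWeights w a) (h0 : 0 ≤ κ) (h1 : κ ≤ 1) :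
    ∫⁻ x, ENNReal.ofReal (x ^ 2) ∂(jumpMeasure a τ2 κ U) ≤
      ENNReal.ofReal ((∑' k, a k * k) * τ2 + 2) := by
  have hs := h.summable_mean.mul_right (τ2 : ℝ)
  have hn : ∀ k : ℕ, 0 ≤ a k * k * τ2 := fun k =>
    mul_nonneg (mul_nonneg (h.a_nonneg k) k.cast_nonneg) τ2.2
  rw [jumpMeasure, lintegral_add_measure, lintegral_add_measure, lintegral_sq_gaussianReal,
    mixture, lintegral_sum_measure, ← tsum_mul_right,
    ENNReal.ofReal_add (tsum_nonneg hn) zero_le_two, ENNReal.ofReal_tsum_of_nonneg hn hs, add_assoc]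
  refine add_le_add (ENNReal.tsum_le_tsum fun k => ?_) ?_
  · rw [lintegral_smul_measure, lintegral_sq_gaussianReal, smul_eq_mul, mul_assoc,
      ENNReal.ofReal_mul (h.a_nonneg k)]
    gcongr
    rw [← ENNReal.ofReal_coe_nnreal]
    push_cast
    rfl
  · calc ((1 : ℝ≥0) : ℝ≥0∞) + ∫⁻ x, ENNReal.ofReal (x ^ 2) ∂(jumpLaw κ U) ≤ 1 + 1 := by
          gcongr
          · simp
          · exact lintegral_sq_jumpLaw_le h0 h1
      _ = _ := by rw [one_add_one_eq_two]; simp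

/-- The finite measure `ν_σ` of the two competing models. -/
theorem exists_levyMeasure (h : IsCompoundWeights w a) (h0 : 0 ≤ κ) (h1 : κ ≤ 1) (σ2 τ2 : ℝ≥0)
    (U : ℝ) : ∃ ν : FiniteMeasure ℝ, (ν : Measure ℝ) = levyMeasure σ2 (jumpMeasure a τ2 κ U) :=
  ⟨⟨_, isFiniteMeasure_levyMeasure σ2
    (ne_top_of_le_ne_top ENNReal.ofReal_ne_top (lintegral_sq_jumpMeasure_le h h0 h1))⟩, rfl⟩

theorem levyCharFun_eq (h : IsCompoundWeights w a) (h0 : 0 ≤ κ) (h1 : κ ≤ 1)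
    {ν : FiniteMeasure ℝ} (hν : (ν : Measure ℝ) = levyMeasure σ2 (jumpMeasure a τ2 κ U))
    (b u : ℝ) :
    levyCharFun b ν u = Complex.exp (Complex.I * u * b + ((-(u ^ 2 / 2) * σ2 +
      genExponent a (Real.exp (-(u ^ 2 / 2) * τ2)) + (Real.exp (-(u ^ 2 / 2)) - 1) +
        (jumpCharFun κ U u - 1) : ℝ) : ℂ)) := by
  have i1 := isFiniteMeasure_jumpMeasure (τ2 := τ2) (U := U) h h0
  have heven : ∀ u, charFun (jumpMeasure a τ2 κ U) (-u) = charFun (jumpMeasure a τ2 κ U) u := by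
    intro u
    have e1 := charFun_jumpMeasure_sub (τ2 := τ2) (U := U) h h0 h1 u
    have e2 := charFun_jumpMeasure_sub (τ2 := τ2) (U := U) h h0 h1 (-u)
    rw [jumpCharFun_neg, neg_sq, ← e1] at e2
    exact sub_left_injective e2
  rw [levyCharFun, levyExponent_levyMeasure
    (ne_top_of_le_ne_top ENNReal.ofReal_ne_top (lintegral_sq_jumpMeasure_le h h0 h1)) heven hν,
    charFun_jumpMeasure_sub h h0 h1]
  congr 1
  push_cast
  ring

/-- Both sides have the same exponent: the Gaussian jumps of variances `k τ2` account for `τ2 M`,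
the standard Gaussian jumps for `N`, and `jumpLaw` for the outer compound Poisson factor. -/
theorem isLevyLaw_compound (h : IsCompoundWeights w a) (h0 : 0 ≤ κ) (h1 : κ ≤ 1)
    {ν : FiniteMeasure ℝ} (hν : (ν : Measure ℝ) = levyMeasure σ2 (jumpMeasure a τ2 κ U))
    (b : ℝ) {P : ProbabilityMeasure ℝ}
    (hP : (P : Measure ℝ) = compound (baseLaw w σ2 τ2 b) (jumpLaw κ U)) : IsLevyLaw b ν P := by
  intro u
  have i1 := isProbabilityMeasure_jumpLaw h0 h1 U
  have i2 := isProbabilityMeasure_baseLaw h σ2 τ2 b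
  rw [hP, charFun_compound, charFun_baseLaw h, charFun_jumpLaw h0 h1, levyCharFun_eq h h0 h1 hν,
    ← Complex.exp_add]
  congr 1
  push_cast
  ring

/-- The Poisson variance lowers the exponent by at most `1` and the perturbed jumps by at most `2`,
whatever `κ` and `U`. Decay is therefore decided by the weights alone. -/
theorem le_norm_levyCharFun (h : IsCompoundWeights w a) (h0 : 0 ≤ κ) (h1 : κ ≤ 1)
    {ν : FiniteMeasure ℝ} (hν : (ν : Measure ℝ) = levyMeasure 0 (jumpMeasure a τ2 κ U))
    (b u : ℝ) :
    Real.exp (-3) * Real.exp (genExponent a (Real.exp (-(u ^ 2 / 2) * τ2))) ≤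
      ‖levyCharFun b ν u‖ := by
  have i1 := isProbabilityMeasure_jumpLaw h0 h1 U
  have hj : -1 ≤ jumpCharFun κ U u := by
    have := norm_charFun_le_one (μ := jumpLaw κ U) u
    rw [charFun_jumpLaw h0 h1, Complex.norm_real, Real.norm_eq_abs] at this
    exact (abs_le.1 this).1
  rw [levyCharFun_eq h h0 h1 hν, Complex.norm_exp, ← Real.exp_add, Real.exp_le_exp]
  have := Real.exp_pos (-(u ^ 2 / 2))
  simp only [Complex.add_re, Complex.ofReal_re, NNReal.coe_zero]
  simp
  linarith

end LevyMeasure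

/-! ### Separation of the hypotheses in the loss -/

section Loss

theorem loss_triangle (s : ℝ) (ν₀ ν₁ ν' : FiniteMeasure ℝ) :
    loss s ν₁ ν₀ ≤ loss s ν' ν₀ + loss s ν' ν₁ := by
  refine iSup₂_le fun f hf => ?_
  refine le_trans ?_ (add_le_add (le_iSup₂ (f := fun f (_ : f ∈ testClass s) =>
    ENNReal.ofReal |(∫ x, f x ∂(ν' : Measure ℝ)) - ∫ x, f x ∂(ν₀ : Measure ℝ)|) f hf)
    (le_iSup₂ (f := fun f (_ : f ∈ testClass s) =>
    ENNReal.ofReal |(∫ x, f x ∂(ν' : Measure ℝ)) - ∫ x, f x ∂(ν₁ : Measure ℝ)|) f hf))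
  rw [← ENNReal.ofReal_add (abs_nonneg _) (abs_nonneg _)]
  refine ENNReal.ofReal_le_ofReal ?_
  rw [add_comm, abs_sub_comm (∫ x, f x ∂(ν' : Measure ℝ)) (∫ x, f x ∂(ν₁ : Measure ℝ))]
  exact abs_sub_le _ _ _

/-- The reduction of the minimax risk to the separation of two hypotheses. -/
theorem le_minimaxProb {b s r ε : ℝ} {N : Set (FiniteMeasure ℝ)} {n : ℕ} {K : ℝ≥0∞} (hK : 1 ≤ K)
    (hK' : K ≠ ∞) {ν₀ ν₁ : FiniteMeasure ℝ} (h₀ : ν₀ ∈ N) (h₁ : ν₁ ∈ N)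
    {P₀ P₁ : ProbabilityMeasure ℝ} (hP₀ : IsLevyLaw b ν₀ P₀) (hP₁ : IsLevyLaw b ν₁ P₁)
    (hdom : SqDom K (P₀ : Measure ℝ) (P₁ : Measure ℝ))
    (hsep : ENNReal.ofReal ε + ENNReal.ofReal ε < ENNReal.ofReal r * loss s ν₁ ν₀) :
    (4 * K ^ n)⁻¹ ≤ minimaxProb b s N r ε n := by
  refine le_iInf fun est => ?_
  set F : FiniteMeasure ℝ → ProbabilityMeasure ℝ → ℝ≥0∞ := fun ν P =>
    Measure.pi (fun _ : Fin n => (P : Measure ℝ))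
      {x | ENNReal.ofReal ε < ENNReal.ofReal r * loss s (est x) ν} with hF
  have hle : ∀ (ν : FiniteMeasure ℝ) (P : ProbabilityMeasure ℝ), ν ∈ N → IsLevyLaw b ν P →
      F ν P ≤ ⨆ ν ∈ N, ⨆ P : ProbabilityMeasure ℝ, ⨆ _ : IsLevyLaw b ν P, F ν P :=
    fun ν P hν hP => (le_iSup₂ (f := fun P (_ : IsLevyLaw b ν P) => F ν P) P hP).trans
      (le_iSup₂ (f := fun ν (_ : ν ∈ N) =>
        ⨆ P : ProbabilityMeasure ℝ, ⨆ _ : IsLevyLaw b ν P, F ν P) ν hν)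
  refine le_trans ?_ (max_le (hle ν₀ P₀ h₀ hP₀) (hle ν₁ P₁ h₁ hP₁))
  refine (hdom.pi n).two_point (one_le_pow₀ hK) (ENNReal.pow_ne_top hK')
    (Set.eq_univ_of_forall fun x => ?_)
  -- If the estimate were close to both measures, the triangle inequality would contradict their
  -- separation.
  by_contra hx
  simp only [Set.mem_union, Set.mem_ofPred_eq, not_or, not_lt] at hx
  refine absurd hsep (not_lt.2 ?_)
  calc ENNReal.ofReal r * loss s ν₁ ν₀
      ≤ ENNReal.ofReal r * (loss s (est x) ν₀ + loss s (est x) ν₁) := by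
        gcongr; exact loss_triangle _ _ _ _
    _ ≤ _ := by rw [mul_add]; exact add_le_add hx.1 hx.2

/-- The oscillating test function. -/
def testFun (A U x : ℝ) : ℝ := A * (Real.cos (U * x) * Real.exp (-(x ^ 2 / 2)))

theorem continuous_testFun (A U : ℝ) : Continuous (testFun A U) := by
  unfold testFun; fun_prop

theorem abs_testFun_le {A : ℝ} (hA : 0 ≤ A) (U x : ℝ) :
    |testFun A U x| ≤ A * Real.exp (-(x ^ 2 / 2)) := by
  rw [testFun, abs_mul, abs_mul, abs_of_nonneg hA, abs_of_pos (Real.exp_pos _)]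
  gcongr
  exact mul_le_of_le_one_left (Real.exp_pos _).le (Real.abs_cos_le_one _)

theorem abs_testFun_le_const {A : ℝ} (hA : 0 ≤ A) (U x : ℝ) : |testFun A U x| ≤ A := by
  refine (abs_testFun_le hA U x).trans (mul_le_of_le_one_right hA ?_)
  exact Real.exp_le_one_iff.2 (neg_nonpos.2 (by positivity))

theorem integrable_testFun {A : ℝ} (hA : 0 ≤ A) (U : ℝ) : Integrable (testFun A U) := by
  have h := (integrable_exp_neg_mul_sq (b := 1 / 2) (by norm_num)).const_mul A
  refine h.mono' (continuous_testFun A U).aestronglyMeasurable (Eventually.of_forall fun x => ?_)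
  refine (abs_testFun_le hA U x).trans (le_of_eq ?_)
  congr 2
  ring

theorem gaussian_fourier (t : ℝ) :
    Integrable (fun x : ℝ => Complex.exp (Complex.I * t * x) * Complex.exp (-(x ^ 2 / 2))) ∧
    ∫ x : ℝ, Complex.exp (Complex.I * t * x) * Complex.exp (-(x ^ 2 / 2)) =
      (Real.pi / (1 / 2) : ℂ) ^ (1 / 2 : ℂ) * Complex.exp (-(t ^ 2 / 2)) := by
  have hb : 0 < (1 / 2 : ℂ).re := by norm_num
  have h := fourierIntegral_gaussian hb t
  have e : ∀ x : ℝ, (-(1 / 2 : ℂ) * x ^ 2) = -(x ^ 2 / 2) := fun x => by ring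
  simp only [e] at h
  refine ⟨?_, ?_⟩
  · have hg := integrable_exp_neg_mul_sq (b := 1 / 2) (by norm_num)
    refine hg.mono' (by fun_prop) (Eventually.of_forall fun x => le_of_eq ?_)
    rw [norm_mul, Complex.norm_exp, Complex.norm_exp]
    simp [← Complex.ofReal_pow]
    ring
  · rw [h]
    congr 2
    ring

/-- The constant `√(2π)` in the Fourier transform of a Gaussian function. -/
def fourierConst : ℝ := ‖(Real.pi / (1 / 2) : ℂ) ^ (1 / 2 : ℂ)‖

/-- The cosine splits the Gaussian transform into two bumps centred at `±U`, where the weight `(1 +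
|u|) ^ s` is of order `(1 + U) ^ s`. -/
theorem norm_fourierT_testFun_le {A : ℝ} (hA : 0 ≤ A) (U u : ℝ) :
    ‖fourierT (testFun A U) u‖ ≤ A * fourierConst *
      (Real.exp (-((u + U) ^ 2 / 2)) + Real.exp (-((u - U) ^ 2 / 2))) := by
  obtain ⟨i1, e1⟩ := gaussian_fourier (u + U)
  obtain ⟨i2, e2⟩ := gaussian_fourier (u - U)
  have key : fourierT (testFun A U) u = (A / 2 : ℂ) *
      ((Real.pi / (1 / 2) : ℂ) ^ (1 / 2 : ℂ) * Complex.exp (-((u + U : ℝ) ^ 2 / 2)) +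
      (Real.pi / (1 / 2) : ℂ) ^ (1 / 2 : ℂ) * Complex.exp (-((u - U : ℝ) ^ 2 / 2))) := by
    rw [← e1, ← e2, ← integral_add i1 i2, ← integral_const_mul, fourierT]
    refine integral_congr_ae (Eventually.of_forall fun x => ?_)
    have c1 : Complex.exp (Complex.I * (u + U : ℝ) * x) =
        Complex.exp (Complex.I * u * x) * Complex.exp (U * x * Complex.I) := by
      rw [← Complex.exp_add]; congr 1; push_cast; ring
    have c2 : Complex.exp (Complex.I * (u - U : ℝ) * x) =
        Complex.exp (Complex.I * u * x) * Complex.exp (-(U * x) * Complex.I) := by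
      rw [← Complex.exp_add]; congr 1; push_cast; ring
    simp only [testFun]
    push_cast at c1 c2 ⊢
    rw [c1, c2, Complex.cos]
    ring
  have n1 : ∀ t : ℝ, ‖Complex.exp (-((t : ℂ) ^ 2 / 2))‖ = Real.exp (-(t ^ 2 / 2)) := by
    intro t
    rw [Complex.norm_exp]
    simp [← Complex.ofReal_pow]
  rw [key, ← mul_add, norm_mul, norm_mul, mul_assoc]
  have hA2 : ‖(A / 2 : ℂ)‖ ≤ A := by
    rw [norm_div, Complex.norm_real, Real.norm_of_nonneg hA]
    simp
    linarith
  refine mul_le_mul hA2 ?_ (by positivity) hA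
  refine mul_le_mul_of_nonneg_left ?_ (norm_nonneg _)
  refine (norm_add_le _ _).trans ?_
  rw [n1, n1]

theorem lintegral_rpow_mul_exp_lt_top (s : ℝ) (hs : 0 ≤ s) :
    ∫⁻ v : ℝ, ENNReal.ofReal ((1 + |v|) ^ s * Real.exp (-(v ^ 2 / 2))) < ∞ := by
  have hg := (integrable_exp_neg_mul_sq (b := 1 / 4) (by norm_num)).const_mul (Real.exp (s ^ 2))
  have h2 : ∀ v : ℝ, (1 + |v|) ^ s * Real.exp (-(v ^ 2 / 2)) ≤
      Real.exp (s ^ 2) * Real.exp (-(1 / 4) * v ^ 2) := by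
    intro v
    have h3 : (1 + |v|) ^ s ≤ Real.exp (|v| * s) := by
      rw [Real.exp_mul]
      refine Real.rpow_le_rpow (by positivity) ?_ hs
      linarith [Real.add_one_le_exp |v|]
    calc _ ≤ Real.exp (|v| * s) * Real.exp (-(v ^ 2 / 2)) := by gcongr
      _ ≤ _ := by
        rw [← Real.exp_add, ← Real.exp_add, Real.exp_le_exp]
        nlinarith [sq_nonneg (|v| / 2 - s), sq_abs v]
  refine lt_of_le_of_lt (lintegral_mono fun v => ENNReal.ofReal_le_ofReal (h2 v)) ?_
  have := hg.2
  rwa [hasFiniteIntegral_iff_ofReal (Eventually.of_forall fun x => by positivity)] at this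

/-- Suitably normalized, the oscillating test functions belong to the test class. -/
theorem exists_testFun_mem (s : ℝ) (hs : 0 ≤ s) :
    ∃ c : ℝ, 0 < c ∧ ∀ U : ℝ, 0 ≤ U → testFun (c * (1 + U) ^ (-s)) U ∈ testClass s := by
  set I : ℝ≥0∞ := ∫⁻ v : ℝ, ENNReal.ofReal ((1 + |v|) ^ s * Real.exp (-(v ^ 2 / 2))) with hI
  have hItop : I ≠ ∞ := (lintegral_rpow_mul_exp_lt_top s hs).ne
  set M : ℝ := fourierConst * (2 * I.toReal) + 1 with hM
  have hC0 : 0 ≤ fourierConst := norm_nonneg _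
  have hM0 : 0 < M := by positivity
  refine ⟨M⁻¹, by positivity, fun U hU => ?_⟩
  set A : ℝ := M⁻¹ * (1 + U) ^ (-s) with hA
  have hA0 : 0 ≤ A := by positivity
  refine ⟨continuous_testFun A U, integrable_testFun hA0 U, ?_⟩
  have hpt : ∀ u : ℝ, ENNReal.ofReal ((1 + |u|) ^ s) * ‖fourierT (testFun A U) u‖ₑ ≤
      ENNReal.ofReal (M⁻¹ * fourierConst) *
        (ENNReal.ofReal ((1 + |u + U|) ^ s * Real.exp (-((u + U) ^ 2 / 2))) +
          ENNReal.ofReal ((1 + |u - U|) ^ s * Real.exp (-((u - U) ^ 2 / 2)))) := by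
    intro u
    rw [← ofReal_norm, ← ENNReal.ofReal_mul (by positivity),
      ← ENNReal.ofReal_add (by positivity) (by positivity), ← ENNReal.ofReal_mul (by positivity)]
    refine ENNReal.ofReal_le_ofReal ?_
    -- Submultiplicativity of the weight: recentring a bump at the origin costs exactly the factor
    -- `(1 + U) ^ s` built into the normalisation.
    have hw : ∀ y : ℝ, 1 + |u| ≤ (1 + U) * (1 + |y|) → (1 + |u|) ^ s * (1 + U) ^ (-s) ≤
        (1 + |y|) ^ s := by
      intro y hy
      have h4 : (1 + |u|) ^ s ≤ (1 + U) ^ s * (1 + |y|) ^ s := by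
        rw [← Real.mul_rpow (by positivity) (by positivity)]
        exact Real.rpow_le_rpow (by positivity) hy hs
      calc _ ≤ ((1 + U) ^ s * (1 + |y|) ^ s) * (1 + U) ^ (-s) := by gcongr
        _ = (1 + |y|) ^ s * ((1 + U) ^ s * (1 + U) ^ (-s)) := by ring
        _ = _ := by rw [← Real.rpow_add (by positivity)]; simp
    have hu1 : 1 + |u| ≤ (1 + U) * (1 + |u + U|) := by
      have : |u| ≤ |u + U| + |U| := by simpa using abs_sub (u + U) U
      rw [abs_of_nonneg hU] at this
      nlinarith [abs_nonneg (u + U)]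
    have hu2 : 1 + |u| ≤ (1 + U) * (1 + |u - U|) := by
      have : |u| ≤ |u - U| + |U| := by simpa using abs_add_le (u - U) U
      rw [abs_of_nonneg hU] at this
      nlinarith [abs_nonneg (u - U)]
    calc (1 + |u|) ^ s * ‖fourierT (testFun A U) u‖
        ≤ (1 + |u|) ^ s * (A * fourierConst *
          (Real.exp (-((u + U) ^ 2 / 2)) + Real.exp (-((u - U) ^ 2 / 2)))) := by
          gcongr; exact norm_fourierT_testFun_le hA0 U u
      _ = (M⁻¹ * fourierConst) * (((1 + |u|) ^ s * (1 + U) ^ (-s)) * Real.exp (-((u + U) ^ 2 / 2)) +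
          ((1 + |u|) ^ s * (1 + U) ^ (-s)) * Real.exp (-((u - U) ^ 2 / 2))) := by
          rw [hA]; ring
      _ ≤ _ := by
          gcongr
          · exact hw _ hu1
          · exact hw _ hu2
  refine (lintegral_mono hpt).trans ?_
  rw [lintegral_const_mul _ (by fun_prop), lintegral_add_left (by fun_prop),
    lintegral_add_right_eq_self (fun v : ℝ =>
      ENNReal.ofReal ((1 + |v|) ^ s * Real.exp (-(v ^ 2 / 2)))) U,
    lintegral_sub_right_eq_self (fun v : ℝ =>
      ENNReal.ofReal ((1 + |v|) ^ s * Real.exp (-(v ^ 2 / 2)))) U, ← hI,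
    ← ENNReal.ofReal_toReal hItop, ← ENNReal.ofReal_add (by positivity) (by positivity),
    ← ENNReal.ofReal_mul (by positivity)]
  refine ENNReal.ofReal_le_one.2 ?_
  rw [mul_assoc, ← two_mul, inv_mul_le_one₀ hM0, hM]
  linarith

/-- The integral is `1/2 + (cos 2U sin 2U - cos U sin U) / (2U)`. Each product is at most `1/2` in
absolute value, so `U ≥ 2` leaves `1/4`. -/
theorem quarter_le_integral_cos_sq {U : ℝ} (hU : 2 ≤ U) :
    1 / 4 ≤ ∫ x in (1 : ℝ)..2, Real.cos (U * x) ^ 2 := by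
  have hU0 : U ≠ 0 := by positivity
  rw [intervalIntegral.integral_comp_mul_left (fun y => Real.cos y ^ 2) hU0, integral_cos_sq,
    smul_eq_mul, ← div_eq_inv_mul, le_div_iff₀ (by positivity)]
  nlinarith [sq_nonneg (Real.cos (U * 2) + Real.sin (U * 2)), Real.sin_sq_add_cos_sq (U * 2),
    sq_nonneg (Real.cos (U * 1) - Real.sin (U * 1)), Real.sin_sq_add_cos_sq (U * 1)]

/-- The mass of the oscillating test function under the oscillating perturbation. -/
theorem exists_le_integral_gaussianReal :
    ∃ c : ℝ, 0 < c ∧ ∀ U : ℝ, 2 ≤ U →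
      c ≤ ∫ x, x ^ 2 * (Real.cos (U * x) ^ 2 * Real.exp (-(x ^ 2 / 2))) ∂(gaussianReal 0 1) := by
  -- A lower bound on `[1, 2]` for the Gaussian density times `e ^ (-x²/2)`, both smallest at `2`;
  -- there also `x² ≥ 1`.
  set L : ℝ := gaussianPDFReal 0 1 2 * Real.exp (-2) with hL
  have hL0 : 0 < L := mul_pos (gaussianPDFReal_pos _ _ _ one_ne_zero) (Real.exp_pos _)
  refine ⟨L * (1 / 4), by positivity, fun U hU => ?_⟩
  set g : ℝ → ℝ := fun x => x ^ 2 * (Real.cos (U * x) ^ 2 * Real.exp (-(x ^ 2 / 2))) with hg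
  have hg0 : ∀ x, 0 ≤ g x := fun x => by positivity
  have hint : Integrable g (gaussianReal 0 1) := by
    have h2 : Integrable (fun x : ℝ => x ^ 2) (gaussianReal 0 1) :=
      (memLp_two_iff_integrable_sq (by fun_prop)).1 (memLp_id_gaussianReal (μ := 0) (v := 1) 2)
    refine h2.mono' (by fun_prop) (Eventually.of_forall fun x => ?_)
    rw [Real.norm_of_nonneg (hg0 x)]
    refine mul_le_of_le_one_right (sq_nonneg x) (mul_le_one₀ ?_ (Real.exp_pos _).le ?_)
    · exact Real.cos_sq_le_one _
    · exact Real.exp_le_one_iff.2 (neg_nonpos.2 (by positivity))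
  have hint' : Integrable (fun x => gaussianPDFReal 0 1 x • g x) := by
    rw [gaussianReal_of_var_ne_zero _ one_ne_zero,
      integrable_withDensity_iff_integrable_smul' (measurable_gaussianPDF _ _)
        (Eventually.of_forall fun x => gaussianPDF_lt_top)] at hint
    simpa only [toReal_gaussianPDF] using hint
  rw [integral_gaussianReal_eq_integral_smul one_ne_zero]
  have hmono : ∫ x in (1 : ℝ)..2, L * Real.cos (U * x) ^ 2 ≤
      ∫ x in (1 : ℝ)..2, gaussianPDFReal 0 1 x • g x := by
    refine intervalIntegral.integral_mono_on (by norm_num)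
      (Continuous.intervalIntegrable (by fun_prop) _ _) hint'.intervalIntegrable fun x hx => ?_
    have h1 : gaussianPDFReal 0 1 2 ≤ gaussianPDFReal 0 1 x := by
      simp only [gaussianPDFReal]
      gcongr ?_ * Real.exp ?_
      push_cast
      nlinarith [hx.1, hx.2]
    have h2 : Real.exp (-2) ≤ Real.exp (-(x ^ 2 / 2)) :=
      Real.exp_le_exp.2 (by nlinarith [hx.1, hx.2])
    have h3 : (1 : ℝ) ≤ x ^ 2 := by nlinarith [hx.1]
    calc L * Real.cos (U * x) ^ 2
        = gaussianPDFReal 0 1 2 * (1 * (Real.cos (U * x) ^ 2 * Real.exp (-2))) := by rw [hL]; ring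
      _ ≤ gaussianPDFReal 0 1 x * (x ^ 2 * (Real.cos (U * x) ^ 2 * Real.exp (-(x ^ 2 / 2)))) := by
          have := gaussianPDFReal_nonneg 0 1 x
          gcongr
  rw [intervalIntegral.integral_const_mul] at hmono
  calc L * (1 / 4) ≤ L * ∫ x in (1 : ℝ)..2, Real.cos (U * x) ^ 2 := by
        gcongr; exact quarter_le_integral_cos_sq hU
    _ ≤ _ := hmono
    _ = ∫ x in Set.Ioc (1 : ℝ) 2, gaussianPDFReal 0 1 x • g x :=
        intervalIntegral.integral_of_le (by norm_num)
    _ ≤ _ := setIntegral_le_integral hint' (Eventually.of_forall fun x =>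
        mul_nonneg (gaussianPDFReal_nonneg _ _ _) (hg0 x))

variable {w a : ℕ → ℝ} {κ U : ℝ}

theorem integral_levyMeasure {σ2 : ℝ≥0} {J : Measure ℝ}
    (hJ : ∫⁻ x, ENNReal.ofReal (x ^ 2) ∂J ≠ ∞) {f : ℝ → ℝ} (hf : Continuous f) {A : ℝ}
    (hA : ∀ x, |f x| ≤ A) :
    ∫ x, f x ∂(levyMeasure σ2 J) = σ2 * f 0 + ∫ x, x ^ 2 * f x ∂J := by
  have := isFiniteMeasure_levyMeasure σ2 hJ
  have hint : Integrable f (levyMeasure σ2 J) :=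
    Integrable.of_bound hf.aestronglyMeasurable A (Eventually.of_forall hA)
  rw [levyMeasure] at hint ⊢
  rw [integral_add_measure hint.left_of_add_measure hint.right_of_add_measure,
    integral_smul_measure, integral_dirac,
    integral_withDensity_eq_integral_toReal_smul (by fun_prop) (by simp)]
  simp [ENNReal.toReal_ofReal (sq_nonneg _)]

theorem integrable_sq_mul {J : Measure ℝ} (hJ : ∫⁻ x, ENNReal.ofReal (x ^ 2) ∂J ≠ ∞)
    {f : ℝ → ℝ} (hf : Continuous f) {A : ℝ} (hA : ∀ x, |f x| ≤ A) :
    Integrable (fun x => x ^ 2 * f x) J := by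
  refine ((integrable_sq_of_lintegral_ne_top hJ).const_mul A).mono' (by fun_prop)
    (Eventually.of_forall fun x => ?_)
  rw [norm_mul, Real.norm_of_nonneg (sq_nonneg x), mul_comm]
  gcongr
  exact hA x

/-- The factor `x²` kills the atom, so the mass correction at zero does not enter the loss. -/
theorem integral_sq_mul_jumpLaw (h0 : 0 ≤ κ) (h1 : κ ≤ 1) {f : ℝ → ℝ} (hf : Continuous f)
    {A : ℝ} (hA : ∀ x, |f x| ≤ A) :
    ∫ x, x ^ 2 * f x ∂(jumpLaw κ U) =
      2⁻¹ * ∫ x, (1 + κ * Real.cos (U * x)) * (x ^ 2 * f x) ∂(gaussianReal 0 1) := by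
  have hint := integrable_sq_mul (J := jumpLaw κ U)
    (ne_top_of_le_ne_top ENNReal.one_ne_top (lintegral_sq_jumpLaw_le h0 h1)) hf hA
  rw [jumpLaw] at hint ⊢
  rw [integral_add_measure hint.left_of_add_measure hint.right_of_add_measure,
    integral_smul_measure, integral_smul_measure, integral_dirac, integral_tilt _ h0 h1]
  simp

/-- The separation of the two competing measures in the loss `ℓ_s`. -/
theorem exists_le_loss (s : ℝ) (hs : 0 ≤ s) : ∃ c : ℝ, 0 < c ∧
    ∀ (w a : ℕ → ℝ) (σ2 τ2 : ℝ≥0) (κ U : ℝ) (ν₀ ν₁ : FiniteMeasure ℝ), IsCompoundWeights w a →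
      0 ≤ κ → κ ≤ 1 → 2 ≤ U → (ν₀ : Measure ℝ) = levyMeasure σ2 (jumpMeasure a τ2 0 U) →
      (ν₁ : Measure ℝ) = levyMeasure σ2 (jumpMeasure a τ2 κ U) →
      ENNReal.ofReal (c * κ * (1 + U) ^ (-s)) ≤ loss s ν₁ ν₀ := by
  obtain ⟨c₁, hc₁, hmem⟩ := exists_testFun_mem s hs
  obtain ⟨c₂, hc₂, hint⟩ := exists_le_integral_gaussianReal
  refine ⟨c₁ * c₂ / 2, by positivity, fun w a σ2 τ2 κ U ν₀ ν₁ h h0 h1 hU hν₀ hν₁ => ?_⟩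
  have hU0 : 0 ≤ U := by linarith
  refine le_trans ?_ (le_iSup₂ (f := fun f (_ : f ∈ testClass s) =>
    ENNReal.ofReal |(∫ x, f x ∂(ν₁ : Measure ℝ)) - ∫ x, f x ∂(ν₀ : Measure ℝ)|) _ (hmem U hU0))
  set A := c₁ * (1 + U) ^ (-s) with hA
  have hA0 : 0 ≤ A := by positivity
  set f := testFun A U with hf
  have hfc : Continuous f := continuous_testFun A U
  have hfA : ∀ x, |f x| ≤ A := abs_testFun_le_const hA0 U
  have hJ : ∀ κ' : ℝ, 0 ≤ κ' → κ' ≤ 1 →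
      ∫⁻ x, ENNReal.ofReal (x ^ 2) ∂(jumpMeasure a τ2 κ' U) ≠ ∞ := fun κ' h0 h1 =>
    ne_top_of_le_ne_top ENNReal.ofReal_ne_top (lintegral_sq_jumpMeasure_le h h0 h1)
  -- All unperturbed components cancel. Since the test function carries the same cosine as the
  -- perturbation, the remaining integrand is a square and does not average out.
  have hdiff : (∫ x, f x ∂(ν₁ : Measure ℝ)) - ∫ x, f x ∂(ν₀ : Measure ℝ) = κ * A / 2 *
      ∫ x, x ^ 2 * (Real.cos (U * x) ^ 2 * Real.exp (-(x ^ 2 / 2))) ∂(gaussianReal 0 1) := by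
    rw [hν₀, hν₁, integral_levyMeasure (hJ κ h0 h1) hfc hfA,
      integral_levyMeasure (hJ 0 le_rfl zero_le_one) hfc hfA]
    have j1 := integrable_sq_mul (hJ κ h0 h1) hfc hfA
    have j0 := integrable_sq_mul (hJ 0 le_rfl zero_le_one) hfc hfA
    rw [jumpMeasure] at j1 j0 ⊢
    rw [jumpMeasure, integral_add_measure j1.left_of_add_measure j1.right_of_add_measure,
      integral_add_measure j0.left_of_add_measure j0.right_of_add_measure,
      integral_sq_mul_jumpLaw h0 h1 hfc hfA, integral_sq_mul_jumpLaw le_rfl zero_le_one hfc hfA]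
    have g2 : Integrable (fun x => x ^ 2 * f x) (gaussianReal 0 1) :=
      integrable_sq_mul (by rw [lintegral_sq_gaussianReal]; simp) hfc hfA
    have g3 : Integrable (fun x => (1 + κ * Real.cos (U * x)) * (x ^ 2 * f x))
        (gaussianReal 0 1) := by
      refine g2.bdd_mul (c := 2) (by fun_prop) (Eventually.of_forall fun x => ?_)
      rw [Real.norm_of_nonneg (one_add_mul_cos_nonneg h0 h1 _)]
      nlinarith [Real.cos_le_one (U * x)]
    simp only [zero_mul, add_zero, one_mul]
    rw [add_sub_add_left_eq_sub, add_sub_add_left_eq_sub, ← mul_sub, ← integral_sub g3 g2,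
      ← integral_const_mul, ← integral_const_mul]
    refine integral_congr_ae (Eventually.of_forall fun x => ?_)
    simp only [hf, testFun]
    ring
  rw [hdiff]
  refine ENNReal.ofReal_le_ofReal (le_trans ?_ (le_abs_self _))
  have := hint U hU
  calc c₁ * c₂ / 2 * κ * (1 + U) ^ (-s) = κ * A / 2 * c₂ := by rw [hA]; ring
    _ ≤ _ := by gcongr

end Loss

/-! ### Trivial, Poisson and negative binomial variances -/

section Weights

theorem isCompoundWeights_trivial : IsCompoundWeights (Pi.single 0 1) 0 where
  w_nonneg k := by
    rcases eq_or_ne k 0 with rfl | hk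
    · simp
    · simp [hk]
  a_nonneg k := le_rfl
  summable_a := summable_zero
  summable_mean := by simp
  hasSum_w z _ _ := by
    have h := hasSum_single (f := fun k => (Pi.single 0 1 : ℕ → ℝ) k * z ^ k) 0
      (fun k hk => by simp [hk])
    simpa [genExponent] using h

theorem genExponent_single (c z : ℝ) : genExponent (Pi.single 1 c) z = c * (z - 1) := by
  rw [genExponent, tsum_eq_single 1 (fun k hk => by simp [hk])]
  simp

theorem isCompoundWeights_poisson {c : ℝ} (hc : 0 ≤ c) :
    IsCompoundWeights (fun k => Real.exp (-c) * (c ^ k / k.factorial)) (Pi.single 1 c) where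
  w_nonneg k := by positivity
  a_nonneg k := by
    rcases eq_or_ne k 1 with rfl | hk
    · simpa using hc
    · simp [hk]
  summable_a := (hasSum_single 1 (fun k hk => by simp [hk])).summable
  summable_mean := (hasSum_single 1 (fun k hk => by simp [hk])).summable
  hasSum_w z _ _ := by
    have h := (NormedSpace.expSeries_div_hasSum_exp (c * z)).mul_left (Real.exp (-c))
    rw [← Real.exp_eq_exp_ℝ, ← Real.exp_add] at h
    rw [genExponent_single, show c * (z - 1) = -c + c * z by ring]
    refine h.congr_fun fun k => ?_
    rw [mul_pow]
    ring

theorem tsum_single_mean (c : ℝ) : ∑' k : ℕ, (Pi.single 1 c : ℕ → ℝ) k * k = c := by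
  rw [tsum_eq_single 1 (fun k hk => by simp [hk])]
  simp

theorem hasSum_logSeries {q : ℝ} (h0 : 0 ≤ q) (h1 : q < 1) :
    HasSum (fun k : ℕ => q ^ k / k) (-Real.log (1 - q)) := by
  have h := Real.hasSum_pow_div_log_of_abs_lt_one (x := q) (by rwa [abs_of_nonneg h0])
  -- The term `k = 0` is `1 / 0 = 0`, so the series starts effectively at `k = 1`.
  rw [hasSum_nat_add_iff' (f := fun k : ℕ => q ^ k / (k : ℝ)) 1 |>.symm]
  simpa using h

theorem genExponent_logSeries {r q z : ℝ} (hq0 : 0 ≤ q) (hq1 : q < 1) (hz0 : 0 ≤ z)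
    (hz1 : z ≤ 1) :
    genExponent (fun k => r * (q ^ k / k)) z = r * (Real.log (1 - q) - Real.log (1 - q * z)) := by
  have hqz : q * z < 1 := (mul_le_of_le_one_right hq0 hz1).trans_lt hq1
  have h := ((hasSum_logSeries (mul_nonneg hq0 hz0) hqz).sub (hasSum_logSeries hq0 hq1)).mul_left r
  rw [genExponent, show r * (Real.log (1 - q) - Real.log (1 - q * z)) =
    r * (-Real.log (1 - q * z) - -Real.log (1 - q)) by ring, ← h.tsum_eq]
  congr 1
  ext1 k
  rw [mul_pow]
  ring

/-- Multiplied by `k!` this is the rising factorial `r (r + 1) ⋯ (r + k - 1)`. -/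
theorem choose_add_sub_one_nonneg {r : ℝ} (hr : 0 < r) (k : ℕ) :
    0 ≤ Ring.choose (r + k - 1) k := by
  have h := Ring.descPochhammer_eq_factorial_smul_choose (r + k - 1) k
  have h2 : 0 ≤ (k.factorial : ℝ) * Ring.choose (r + k - 1) k := by
    rw [← nsmul_eq_mul, ← h, Polynomial.descPochhammer_smeval_eq_ascPochhammer]
    rw [show r + k - 1 - k + 1 = r by ring, Polynomial.ascPochhammer_smeval_eq_eval]
    exact (ascPochhammer_pos k r hr).le
  exact nonneg_of_mul_nonneg_right h2 (by positivity)

theorem hasSum_negativeBinomial (r : ℝ) {x : ℝ} (h0 : 0 ≤ x) (h1 : x < 1) :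
    HasSum (fun k : ℕ => Ring.choose (r + k - 1) k * x ^ k) ((1 - x) ^ (-r)) := by
  have h := (Real.one_div_one_sub_rpow_hasFPowerSeriesOnBall_zero r).hasSum (y := x) (by
    simpa [enorm_eq_nnnorm, ← NNReal.coe_lt_coe, abs_of_nonneg h0] using h1)
  rw [zero_add, one_div, ← Real.rpow_neg (by linarith)] at h
  refine h.congr_fun fun k => ?_
  simp [mul_comm]

/-- The negative binomial law is compound Poisson with logarithmic jumps: its generating function is
`((1 - q) / (1 - q z)) ^ r`, and expanding its logarithm gives the intensities `r q ^ k / k`. This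
is the source of polynomial decay. -/
theorem isCompoundWeights_negativeBinomial {r q : ℝ} (hr : 0 < r) (hq0 : 0 ≤ q) (hq1 : q < 1) :
    IsCompoundWeights (fun k => (1 - q) ^ r * (Ring.choose (r + k - 1) k * q ^ k))
      (fun k => r * (q ^ k / k)) where
  w_nonneg k := mul_nonneg (Real.rpow_nonneg (by linarith) _)
    (mul_nonneg (choose_add_sub_one_nonneg hr k) (pow_nonneg hq0 k))
  a_nonneg k := by positivity
  summable_a := ((hasSum_logSeries hq0 hq1).mul_left r).summable
  summable_mean := by
    refine ((summable_geometric_of_lt_one hq0 hq1).mul_left r).of_nonneg_of_le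
      (fun k => by positivity) fun k => ?_
    rw [mul_assoc]
    gcongr
    rcases Nat.eq_zero_or_pos k with rfl | hk
    · simp
    · have : (k : ℝ) ≠ 0 := by positivity
      rw [div_mul_cancel₀ _ this]
  hasSum_w z hz0 hz1 := by
    have hqz : q * z < 1 := (mul_le_of_le_one_right hq0 hz1).trans_lt hq1
    have h := (hasSum_negativeBinomial r (mul_nonneg hq0 hz0) hqz).mul_left ((1 - q) ^ r)
    rw [genExponent_logSeries hq0 hq1 hz0 hz1]
    have e : Real.exp (r * (Real.log (1 - q) - Real.log (1 - q * z))) =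
        (1 - q) ^ r * (1 - q * z) ^ (-r) := by
      rw [Real.rpow_def_of_pos (by linarith), Real.rpow_def_of_pos (by linarith), ← Real.exp_add]
      congr 1
      ring
    rw [e]
    refine h.congr_fun fun k => ?_
    rw [mul_pow]
    ring

theorem tsum_logSeries_mean {r q : ℝ} (hq0 : 0 ≤ q) (hq1 : q < 1) (hr : 0 ≤ r) :
    ∑' k : ℕ, r * (q ^ k / k) * k ≤ r * (q / (1 - q)) := by
  have h := ((hasSum_geometric_of_lt_one hq0 hq1).mul_left q).mul_left r
  rw [← div_eq_mul_inv] at h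
  rw [← h.tsum_eq]
  have hs : Summable fun k : ℕ => r * (q ^ k / k) * k := by
    refine ((summable_geometric_of_lt_one hq0 hq1).mul_left r).of_nonneg_of_le
      (fun k => by positivity) fun k => ?_
    rw [mul_assoc]
    gcongr
    rcases Nat.eq_zero_or_pos k with rfl | hk
    · simp
    · have : (k : ℝ) ≠ 0 := by positivity
      rw [div_mul_cancel₀ _ this]
  rw [hs.tsum_eq_zero_add]
  simp only [Nat.cast_zero, mul_zero, zero_add]
  refine le_of_eq (tsum_congr fun k => ?_)
  have : ((k + 1 : ℕ) : ℝ) ≠ 0 := by positivity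
  rw [mul_assoc, div_mul_cancel₀ _ this, pow_succ']

end Weights

/-! ### Choice of parameters and the minimax bounds -/

section Assembly

variable {w a : ℕ → ℝ}

theorem damped_le_of_forall {ι : Type*} {p : ι → ℝ} (hp : ∀ i, 0 ≤ p i) {U δ : ℝ} (b : ℝ)
    {v : ι → ℝ≥0} (hδ : ∀ i, damping U (v i) ≤ δ) :
    mixture (fun i => p i * damping U (v i)) (fun i => gaussianReal b (v i + 1)) ≤
      ENNReal.ofReal δ • mixture p fun i => gaussianReal b (v i + 1) := by
  rw [mixture_mul_left hp, mixture, smul_sum_measure]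
  refine sum_measure_mono fun i => ?_
  rw [smul_comm]
  gcongr
  exact hδ i

/-- The damping of the frequency `U` without a Gaussian component. -/
theorem damped_baseLaw_le (h : IsCompoundWeights w a) (τ2 : ℝ≥0) (b U : ℝ) :
    mixture (fun i => baseWeight w i * damping U (baseVar 0 τ2 i))
        (fun i => gaussianReal b (baseVar 0 τ2 i + 1)) ≤
      ENNReal.ofReal (2 * Real.exp (1 + genExponent a (Real.exp (-(U ^ 2 / 4) * τ2)) -
        genExponent a (Real.exp (-(1 / 4) * τ2))) + Real.exp (-(U ^ 2 / 4))) •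
      mixture (baseWeight w) fun i => gaussianReal b (baseVar 0 τ2 i + 1) := by
  refine (mixture_damping_le (baseWeight_nonneg h) (Real.exp_pos _)
    (hasSum_baseWeight_mul_exp h 0 τ2 (θ := U ^ 2 / 4) (by positivity))
    (le_mixture_baseVar_add_one h τ2 b)).trans ?_
  rw [mul_div_assoc, ← Real.exp_sub]
  gcongr ENNReal.ofReal (2 * Real.exp ?_ + _) • _
  have : Real.exp (-(U ^ 2 / 4)) ≤ 1 := Real.exp_le_one_iff.2 (neg_nonpos.2 (by positivity))
  simp only [NNReal.coe_zero]
  linarith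

theorem univ_le (h : IsCompoundWeights w a) {κ U : ℝ} (h0 : 0 ≤ κ) (h1 : κ ≤ 1) {σ2 τ2 : ℝ≥0}
    {ν : FiniteMeasure ℝ} (hν : (ν : Measure ℝ) = levyMeasure σ2 (jumpMeasure a τ2 κ U))
    {C : ℝ} (hC : σ2 + ((∑' k, a k * k) * τ2 + 2) ≤ C) :
    (ν : Measure ℝ) Set.univ ≤ ENNReal.ofReal C := by
  rw [hν, levyMeasure_univ]
  refine le_trans ?_ (ENNReal.ofReal_le_ofReal hC)
  have : 0 ≤ ∑' k, a k * k := tsum_nonneg fun k => mul_nonneg (h.a_nonneg k) k.cast_nonneg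
  rw [ENNReal.ofReal_add σ2.coe_nonneg (by positivity), ENNReal.ofReal_coe_nnreal]
  gcongr
  exact lintegral_sq_jumpMeasure_le h h0 h1

/-- The lower bound for the minimax probability in the two-point model. -/
theorem exists_le_minimaxProb (s : ℝ) (hs : 0 ≤ s) : ∃ c : ℝ, 0 < c ∧
    ∀ (w a : ℕ → ℝ) (σ2 τ2 : ℝ≥0) (κ U δ b r ε Q : ℝ) (n : ℕ) (N : Set (FiniteMeasure ℝ)),
      IsCompoundWeights w a → 0 ≤ κ → κ ≤ 1 → 2 ≤ U → Real.exp (-(U ^ 2 / 2)) ≤ δ →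
      mixture (fun i => baseWeight w i * damping U (baseVar σ2 τ2 i))
          (fun i => gaussianReal b (baseVar σ2 τ2 i + 1)) ≤
        ENNReal.ofReal δ • mixture (baseWeight w) (fun i => gaussianReal b (baseVar σ2 τ2 i + 1)) →
      n * (κ * δ) ^ 2 ≤ Q →
      (∀ κ' : ℝ, 0 ≤ κ' → κ' ≤ 1 → ∀ ν : FiniteMeasure ℝ,
        (ν : Measure ℝ) = levyMeasure σ2 (jumpMeasure a τ2 κ' U) → ν ∈ N) →
      0 ≤ r → 0 ≤ ε → 2 * ε < r * (c * κ * (1 + U) ^ (-s)) →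
      (4 * ENNReal.ofReal (Real.exp (Q * Real.exp 3)))⁻¹ ≤ minimaxProb b s N r ε n := by
  -- The constant depends on `s` only, so weights, variances and frequency may all vary with `n`.
  obtain ⟨c, hc, hloss⟩ := exists_le_loss s hs
  refine ⟨c, hc, ?_⟩
  intro w a σ2 τ2 κ U δ b r ε Q n N h h0 h1 hU hδ hE hQ hN hr hε hsep
  obtain ⟨ν₀, hν₀⟩ := exists_levyMeasure h le_rfl zero_le_one σ2 τ2 U
  obtain ⟨ν₁, hν₁⟩ := exists_levyMeasure h h0 h1 σ2 τ2 U
  have i0 := isProbabilityMeasure_jumpLaw le_rfl zero_le_one U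
  have i1 := isProbabilityMeasure_jumpLaw h0 h1 U
  have iB := isProbabilityMeasure_baseLaw h σ2 τ2 b
  have hδ0 : 0 ≤ δ := (Real.exp_pos _).le.trans hδ
  obtain ⟨hd₁, hd₂⟩ := mixture_conv_jumpLaw (baseWeight_nonneg h) (hasSum_baseWeight h) h0 h1 hδ hE
  have hdom := sqDom_compound (B := baseLaw w σ2 τ2 b) ENNReal.ofReal_ne_top
    (jumpLaw_le h0 h1 U) hd₁ hd₂
  have hK : 1 + ENNReal.ofReal (κ * δ) ^ 2 * ENNReal.ofReal (Real.exp 3) =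
      ENNReal.ofReal (1 + (κ * δ) ^ 2 * Real.exp 3) := by
    rw [ENNReal.ofReal_add zero_le_one (by positivity),
      ENNReal.ofReal_mul (p := (κ * δ) ^ 2) (by positivity), ENNReal.ofReal_pow (by positivity), ENNReal.ofReal_one]
  refine le_trans ?_ (le_minimaxProb (ν₀ := ν₀) (ν₁ := ν₁)
    (P₀ := ⟨compound (baseLaw w σ2 τ2 b) (jumpLaw 0 U), inferInstance⟩)
    (P₁ := ⟨compound (baseLaw w σ2 τ2 b) (jumpLaw κ U), inferInstance⟩)
    le_self_add (by rw [hK]; exact ENNReal.ofReal_ne_top)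
    (hN 0 le_rfl zero_le_one _ hν₀) (hN κ h0 h1 _ hν₁)
    (isLevyLaw_compound h le_rfl zero_le_one hν₀ b rfl) (isLevyLaw_compound h h0 h1 hν₁ b rfl)
    hdom ?_)
  · refine ENNReal.inv_le_inv.2 ?_
    gcongr
    rw [hK, ← ENNReal.ofReal_pow (by positivity)]
    refine ENNReal.ofReal_le_ofReal ?_
    calc (1 + (κ * δ) ^ 2 * Real.exp 3) ^ n ≤ Real.exp ((κ * δ) ^ 2 * Real.exp 3) ^ n := by
          gcongr
          rw [add_comm]
          exact Real.add_one_le_exp _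
      _ = Real.exp (n * (κ * δ) ^ 2 * Real.exp 3) := by rw [← Real.exp_nat_mul, mul_assoc]
      _ ≤ _ := by gcongr
  · calc ENNReal.ofReal ε + ENNReal.ofReal ε = ENNReal.ofReal (2 * ε) := by
          rw [← ENNReal.ofReal_add hε hε, two_mul]
      _ < ENNReal.ofReal (r * (c * κ * (1 + U) ^ (-s))) :=
          (ENNReal.ofReal_lt_ofReal_iff (lt_of_le_of_lt (by positivity) hsep)).2 hsep
      _ = ENNReal.ofReal r * ENNReal.ofReal (c * κ * (1 + U) ^ (-s)) := ENNReal.ofReal_mul hr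
      _ ≤ _ := by gcongr; exact hloss w a σ2 τ2 κ U ν₀ ν₁ h h0 h1 hU hν₀ hν₁

theorem liminf_pos_of_eventually_le {f : ℕ → ℝ≥0∞} {n₀ : ℕ} {Q : ℝ}
    (hf : ∀ n : ℕ, n₀ ≤ n → (4 * ENNReal.ofReal (Real.exp Q))⁻¹ ≤ f n) :
    0 < liminf f atTop := by
  refine lt_of_lt_of_le ?_ (le_liminf_of_le (by isBoundedDefault)
    (eventually_atTop.2 ⟨n₀, hf⟩))
  exact ENNReal.inv_pos.2 (ENNReal.mul_ne_top (by simp) ENNReal.ofReal_ne_top)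

theorem one_le_log {n : ℕ} (hn : 3 ≤ n) : 1 ≤ Real.log n := by
  rw [Real.le_log_iff_exp_le (by positivity)]
  have : (3 : ℝ) ≤ n := by exact_mod_cast hn
  linarith [Real.exp_one_lt_d9]

/-- Rates are matched by frequencies of the same order. -/
theorem lt_rate_mul {c A L U s : ℝ} (hc : 0 < c) (hA : 0 < A) (hL : 0 < L) (hs : 0 ≤ s)
    (hU : 0 ≤ U) (hUL : 1 + U ≤ A * L) :
    2 * (c * A ^ (-s) / 4) < L ^ s * (c * 1 * (1 + U) ^ (-s)) := by
  have h1 : (A * L) ^ (-s) ≤ (1 + U) ^ (-s) :=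
    Real.rpow_le_rpow_of_nonpos (by positivity) hUL (by linarith)
  have h2 : L ^ s * (A * L) ^ (-s) = A ^ (-s) := by
    rw [Real.mul_rpow hA.le hL.le, mul_left_comm, ← Real.rpow_add hL]
    simp
  have h3 : 0 < A ^ (-s) := by positivity
  calc 2 * (c * A ^ (-s) / 4) < c * A ^ (-s) := by nlinarith [mul_pos hc h3]
    _ = L ^ s * (c * 1 * (A * L) ^ (-s)) := by rw [← h2]; ring
    _ ≤ _ := by gcongr

/-- With `κ = 1`, a damping of order `n ^ (-1/2)` is exactly what keeps the `n`-sample χ² distance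
bounded. -/
theorem mul_sq_le_of_le_exp {n : ℕ} {δ D : ℝ} (hn : 0 < n) (hδ : 0 ≤ δ)
    (h : δ ≤ D * Real.exp (-(Real.log n / 2))) : n * (1 * δ) ^ 2 ≤ D ^ 2 := by
  have hn' : (0 : ℝ) < n := by exact_mod_cast hn
  calc (n : ℝ) * (1 * δ) ^ 2 ≤ n * (D * Real.exp (-(Real.log n / 2))) ^ 2 := by
        rw [one_mul]; gcongr
    _ = D ^ 2 * (n * Real.exp (-Real.log n)) := by
        rw [mul_pow, ← Real.exp_nat_mul]
        push_cast
        rw [show (2 : ℝ) * -(Real.log n / 2) = -Real.log n by ring]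
        ring
    _ = D ^ 2 := by rw [Real.exp_neg, Real.exp_log hn', mul_inv_cancel₀ hn'.ne', mul_one]

/-- The variance is never below `σ²`, so every component damps by at least `damping U σ²`. This is
at most `n ^ (-1/2)` once `U` is a large multiple of `√(log n)`. -/
theorem minimax_gaussian {σ : ℝ} (hσ : 0 < σ) {C : ℝ} (hC : σ ^ 2 + 2 ≤ C) (b s : ℝ)
    (hs : 0 < s) : ∃ ε : ℝ, 0 < ε ∧
      0 < liminf (fun n : ℕ => minimaxProb b s (classA C σ) (Real.log n ^ (s / 2)) ε n) atTop := by
  obtain ⟨c, hc, hmain⟩ := exists_le_minimaxProb s hs.le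
  set σ2 : ℝ≥0 := Real.toNNReal (σ ^ 2) with hσ2
  have hσ2r : (σ2 : ℝ) = σ ^ 2 := Real.coe_toNNReal _ (sq_nonneg σ)
  -- Chosen so that `A ≥ 1` and `A σ² ≥ σ² + 1`, hence `A² σ² / (σ² + 1) ≥ 1`.
  set A : ℝ := 2 + (σ ^ 2 + 1) / σ ^ 2 with hA
  have hA2 : 2 ≤ A := by rw [hA]; linarith [show 0 ≤ (σ ^ 2 + 1) / σ ^ 2 by positivity]
  refine ⟨c * (1 + A) ^ (-s) / 4, by positivity, ?_⟩
  refine liminf_pos_of_eventually_le (n₀ := 3) (Q := 1 ^ 2 * Real.exp 3) fun n hn => ?_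
  have hlog := one_le_log hn
  set L : ℝ := Real.sqrt (Real.log n) with hL
  have hL1 : 1 ≤ L := Real.one_le_sqrt.2 hlog
  have hL2 : L ^ 2 = Real.log n := Real.sq_sqrt (by linarith)
  set U : ℝ := A * L with hU
  have hU2 : 2 ≤ U := by nlinarith
  have hrate : Real.log n ^ (s / 2) = L ^ s := by
    rw [hL, Real.sqrt_eq_rpow, ← Real.rpow_mul (by linarith)]
    congr 1
    ring
  have hdU : damping U σ2 ≤ 1 * Real.exp (-(Real.log n / 2)) := by
    rw [one_mul, damping, Real.exp_le_exp, neg_le_neg_iff, hU, mul_pow, hL2, hσ2r,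
      div_le_div_iff₀ two_pos (by positivity)]
    have hAσ : σ ^ 2 + 1 ≤ A ^ 2 * σ ^ 2 := by
      have h1 : σ ^ 2 + 1 ≤ A * σ ^ 2 := by
        rw [hA, add_mul, div_mul_cancel₀ _ (by positivity)]
        nlinarith [sq_nonneg σ]
      nlinarith [sq_nonneg σ, mul_nonneg (mul_nonneg (by linarith : (0 : ℝ) ≤ A)
        (by linarith : 0 ≤ A - 1)) (sq_nonneg σ)]
    nlinarith
  refine hmain (Pi.single 0 1) 0 σ2 0 1 U (damping U σ2) b _ _ _ n _ isCompoundWeights_trivial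
    zero_le_one le_rfl hU2 ?_ (damped_le_of_forall (baseWeight_nonneg isCompoundWeights_trivial) b
      fun i => ?_) (mul_sq_le_of_le_exp (by omega) (damping_nonneg _ _) hdU) ?_ (by positivity)
    (by positivity) ?_
  · rw [damping, Real.exp_le_exp, neg_le_neg_iff, hσ2r, div_le_div_iff₀ (by positivity) two_pos]
    nlinarith [sq_nonneg U, sq_nonneg σ]
  · rw [damping, damping, Real.exp_le_exp, neg_le_neg_iff,
      div_le_div_iff₀ (by positivity) (by positivity)]
    have : (σ2 : ℝ) ≤ baseVar σ2 0 i := by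
      rw [baseVar]; push_cast; simp
    nlinarith [sq_nonneg U, mul_nonneg (sq_nonneg U) (sub_nonneg.2 this)]
  · intro κ' h0 h1 ν hν
    refine ⟨by rw [hν, levyMeasure_singleton_zero]; rfl,
      univ_le isCompoundWeights_trivial h0 h1 hν ?_⟩
    rw [hσ2r]
    simpa using hC
  · rw [hrate]
    refine lt_rate_mul hc (by linarith) (by linarith) hs.le (by linarith) ?_
    nlinarith

theorem inv_le_exp_neg_three {Cbar : ℝ} (hCbar : Real.exp 3 ≤ Cbar) : Cbar⁻¹ ≤ Real.exp (-3) := by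
  rw [Real.exp_neg]
  exact inv_anti₀ (Real.exp_pos _) hCbar

theorem one_sub_le_exp_neg_sub (x : ℝ) : 1 - Real.exp (-x) ≤ x := by
  linarith [Real.add_one_le_exp (-x)]

/-- Poisson intensity `α U` with jump variance `U ^ (-2)`: the exponent `α U (e ^ (-u²/(2U²)) - 1)`
stays above `-α|u|`, by the linear bound for `|u| ≤ U` and by saturation at `-α U` beyond. At the
frequency `U` it is of order `-α U`, so `U ~ log n` suffices, and the added mass `α / U` is at most
`1`. -/
theorem minimax_exponential {C Cbar : ℝ} (hC : 3 ≤ C) (hCbar : Real.exp 3 ≤ Cbar) {α : ℝ}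
    (hα : 0 < α) (b s : ℝ) (hs : 0 < s) : ∃ ε : ℝ, 0 < ε ∧
      0 < liminf (fun n : ℕ => minimaxProb b s (classB b C Cbar α) (Real.log n ^ s) ε n) atTop := by
  obtain ⟨c, hc, hmain⟩ := exists_le_minimaxProb s hs.le
  -- `α A ≥ 4` makes `α U / 8 ≥ log n / 2`; `A ≥ α` bounds the mass `α / U`; `A ≥ 4` handles `U ≥ 2`
  -- and the term `e ^ (-U²/4)`.
  set A : ℝ := 4 / α + 4 + α with hA
  have hA4 : 4 ≤ A := by rw [hA]; linarith [show 0 ≤ 4 / α by positivity]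
  have hAα : 4 ≤ α * A := by
    rw [hA, mul_add, mul_add, mul_div_cancel₀ _ hα.ne']
    nlinarith
  have hAα' : α ≤ A := by rw [hA]; linarith [show 0 ≤ 4 / α by positivity]
  set D : ℝ := 2 * Real.exp (1 + α) + 1 with hD
  refine ⟨c * (1 + A) ^ (-s) / 4, by positivity, ?_⟩
  refine liminf_pos_of_eventually_le (n₀ := 3) (Q := D ^ 2 * Real.exp 3) fun n hn => ?_
  have hlog := one_le_log hn
  set U : ℝ := A * Real.log n with hU
  have hUA : A ≤ U := le_mul_of_one_le_right (by linarith) hlog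
  have hU2 : 2 ≤ U := by linarith
  have hU0 : 0 < U := by linarith
  set τ2 : ℝ≥0 := Real.toNNReal (U ^ 2)⁻¹ with hτ2
  have hτ : (τ2 : ℝ) = (U ^ 2)⁻¹ := Real.coe_toNNReal _ (by positivity)
  have hw := isCompoundWeights_poisson (c := α * U) (by positivity)
  set δ : ℝ := 2 * Real.exp (1 + genExponent (Pi.single 1 (α * U)) (Real.exp (-(U ^ 2 / 4) * τ2)) -
    genExponent (Pi.single 1 (α * U)) (Real.exp (-(1 / 4) * τ2))) + Real.exp (-(U ^ 2 / 4)) with hδ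
  have hδD : δ ≤ D * Real.exp (-(Real.log n / 2)) := by
    have e1 : Real.exp (-(U ^ 2 / 4)) ≤ Real.exp (-(Real.log n / 2)) := by
      rw [Real.exp_le_exp]
      nlinarith
    have hfour : Real.exp (-(U ^ 2 / 4) * τ2) ≤ 7 / 8 := by
      rw [hτ, neg_mul, div_mul_eq_mul_div, mul_inv_cancel₀ (by positivity), Real.exp_neg]
      have := Real.add_one_le_exp (1 / 4 : ℝ)
      rw [inv_le_comm₀ (Real.exp_pos _) (by norm_num)]
      linarith
    have hone : 1 - Real.exp (-(1 / 4) * τ2) ≤ (U ^ 2)⁻¹ := by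
      have := one_sub_le_exp_neg_sub (1 / 4 * τ2 : ℝ)
      rw [← neg_mul, hτ] at this
      rw [hτ]
      linarith [show 0 ≤ (U ^ 2)⁻¹ by positivity]
    have e2 : 1 + genExponent (Pi.single 1 (α * U)) (Real.exp (-(U ^ 2 / 4) * τ2)) -
        genExponent (Pi.single 1 (α * U)) (Real.exp (-(1 / 4) * τ2)) ≤
          (1 + α) + -(Real.log n / 2) := by
      rw [genExponent_single, genExponent_single]
      have f1 : α * U * (Real.exp (-(U ^ 2 / 4) * τ2) - 1) ≤ -(Real.log n / 2) := by
        have : 4 * Real.log n ≤ α * U := by rw [hU, ← mul_assoc]; gcongr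
        nlinarith
      have f2 : α * U * (1 - Real.exp (-(1 / 4) * τ2)) ≤ α := by
        calc α * U * (1 - Real.exp (-(1 / 4) * τ2)) ≤ α * U * (U ^ 2)⁻¹ := by gcongr
          _ = α / U := by field_simp
          _ ≤ α := div_le_self hα.le (by linarith)
      linarith
    calc δ ≤ 2 * Real.exp ((1 + α) + -(Real.log n / 2)) + Real.exp (-(Real.log n / 2)) := by
          rw [hδ]; gcongr
      _ = _ := by rw [Real.exp_add, hD]; ring
  have hδ0 : 0 ≤ δ := by positivity
  refine hmain _ _ 0 τ2 1 U δ b _ _ _ n _ hw zero_le_one le_rfl hU2 ?_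
    (damped_baseLaw_le hw τ2 b U) (mul_sq_le_of_le_exp (by omega) hδ0 hδD) ?_ (by positivity)
    (by positivity) ?_
  · calc Real.exp (-(U ^ 2 / 2)) ≤ Real.exp (-(U ^ 2 / 4)) := by
          rw [Real.exp_le_exp]; nlinarith
      _ ≤ δ := by rw [hδ]; exact le_add_of_nonneg_left (by positivity)
  · intro κ' h0 h1 ν hν
    refine ⟨by rw [hν, levyMeasure_singleton_zero]; rfl, univ_le hw h0 h1 hν ?_, fun u => ?_⟩
    · rw [tsum_single_mean, hτ, NNReal.coe_zero]
      have : α * U * (U ^ 2)⁻¹ ≤ 1 := by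
        rw [show α * U * (U ^ 2)⁻¹ = α / U by field_simp, div_le_one hU0]
        linarith
      linarith
    · refine le_trans ?_ (le_norm_levyCharFun hw h0 h1 hν b u)
      gcongr
      · exact inv_le_exp_neg_three hCbar
      · rw [genExponent_single, hτ]
        have hpos := Real.exp_pos (-(u ^ 2 / 2) * (U ^ 2)⁻¹)
        rcases le_total U |u| with hu | hu
        · nlinarith [mul_le_mul_of_nonneg_left hu hα.le, mul_pos (mul_pos hα hU0) hpos]
        · have h3 := one_sub_le_exp_neg_sub (u ^ 2 / 2 * (U ^ 2)⁻¹)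
          rw [← neg_mul] at h3
          have h4 : α * U * (u ^ 2 / 2 * (U ^ 2)⁻¹) ≤ α * |u| := by
            rw [show α * U * (u ^ 2 / 2 * (U ^ 2)⁻¹) = α * (|u| * (|u| / (2 * U))) by
              rw [← sq_abs u]; field_simp]
            gcongr
            refine mul_le_of_le_one_right (abs_nonneg u) ?_
            rw [div_le_one (by positivity)]
            linarith
          have h5 := mul_le_mul_of_nonneg_left h3 (by positivity : 0 ≤ α * U)
          linarith
  · refine lt_rate_mul hc (by linarith) (by linarith) hs.le (by linarith) ?_
    rw [hU, add_mul]
    linarith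

/-- Here no damping is needed: at the fixed frequency `2` the amplitude `n ^ (-1/2)` alone keeps the
hypotheses close, and the characteristic function is bounded below by `e ^ (-3)`. -/
theorem minimax_parametric {C Cbar : ℝ} (hC : 3 ≤ C) (hCbar : Real.exp 3 ≤ Cbar) {β : ℝ}
    (hβ : 0 ≤ β) (b s : ℝ) (hs : 0 < s) : ∃ ε : ℝ, 0 < ε ∧
      0 < liminf (fun n : ℕ => minimaxProb b s (classC b C Cbar β) ((n : ℝ) ^ (1 / 2 : ℝ)) ε n)
        atTop := by
  obtain ⟨c, hc, hmain⟩ := exists_le_minimaxProb s hs.le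
  refine ⟨c * (1 + 2) ^ (-s) / 4, by positivity, ?_⟩
  refine liminf_pos_of_eventually_le (n₀ := 1) (Q := 1 * Real.exp 3) fun n hn => ?_
  have hn1 : (1 : ℝ) ≤ n := by exact_mod_cast hn
  have hn0 : (0 : ℝ) < n := by linarith
  set κ : ℝ := (n : ℝ) ^ (-(1 / 2) : ℝ) with hκ
  have hκ0 : 0 < κ := by positivity
  have hκ1 : κ ≤ 1 := Real.rpow_le_one_of_one_le_of_nonpos hn1 (by norm_num)
  have hnκ : (n : ℝ) ^ (1 / 2 : ℝ) * κ = 1 := by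
    rw [hκ, ← Real.rpow_add hn0]; simp
  have hnκ2 : n * (κ * 1) ^ 2 ≤ 1 := by
    have : ((n : ℝ) ^ (1 / 2 : ℝ)) ^ 2 = n := by
      rw [← Real.sqrt_eq_rpow, Real.sq_sqrt hn0.le]
    nth_rewrite 1 [← this]
    rw [mul_one, ← mul_pow, hnκ, one_pow]
  refine hmain (Pi.single 0 1) 0 0 0 κ 2 1 b _ _ _ n _ isCompoundWeights_trivial
    hκ0.le hκ1 le_rfl ?_ (damped_le_of_forall (baseWeight_nonneg isCompoundWeights_trivial) b
      fun i => damping_le_one _ (NNReal.coe_nonneg _)) hnκ2 ?_ (by positivity) (by positivity) ?_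
  · exact Real.exp_le_one_iff.2 (by norm_num)
  · intro κ' h0 h1 ν hν
    refine ⟨by rw [hν, levyMeasure_singleton_zero]; rfl,
      univ_le isCompoundWeights_trivial h0 h1 hν ?_, fun u => ?_⟩
    · simp; linarith
    · refine le_trans ?_ (le_norm_levyCharFun isCompoundWeights_trivial h0 h1 hν b u)
      refine mul_le_mul (inv_le_exp_neg_three hCbar) ?_ (by positivity) (Real.exp_pos _).le
      simp only [genExponent, Pi.zero_apply, zero_mul, tsum_zero, Real.exp_zero]
      exact Real.rpow_le_one_of_one_le_of_nonpos (by linarith [abs_nonneg u]) (by linarith)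
  · have h3 : 0 < c * (1 + 2 : ℝ) ^ (-s) := by positivity
    calc 2 * (c * (1 + 2 : ℝ) ^ (-s) / 4) < c * (1 + 2 : ℝ) ^ (-s) := by
          generalize c * (1 + 2 : ℝ) ^ (-s) = y at *
          linarith
      _ = ((n : ℝ) ^ (1 / 2 : ℝ) * κ) * (c * (1 + 2 : ℝ) ^ (-s)) := by rw [hnκ, one_mul]
      _ = _ := by ring

/-- With `T = q / (1 - q) = θ U²` and `τ2 = 2 / U²`, the negative binomial factor is `(1 + T (1 -
z)) ^ (-β/2)` at `z = e ^ (-u²/U²)`. Since `T (1 - z) ≤ θ u²`, it is at least `(1 + |u|) ^ (-β)`; in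
the damping it is at most a multiple of `U ^ (-β)`, so `U ~ n ^ (1/(2β))`. -/
theorem minimax_polynomial {C Cbar : ℝ} (hC : 3 ≤ C) (hCbar : Real.exp 3 ≤ Cbar) {β : ℝ}
    (hβ : 0 < β) (b s : ℝ) (hs : 0 < s) : ∃ ε : ℝ, 0 < ε ∧
      0 < liminf (fun n : ℕ => minimaxProb b s (classC b C Cbar β) ((n : ℝ) ^ (s / (2 * β))) ε n)
        atTop := by
  obtain ⟨c, hc, hmain⟩ := exists_le_minimaxProb s hs.le
  set r : ℝ := β / 2 with hr
  have hr0 : 0 < r := by positivity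
  -- The mass contributed by the variance part is at most `r T τ2 = β θ`; this `θ` keeps it below
  -- `1` for every `β`, so that `C` need not depend on `β`.
  set θ : ℝ := 1 / (1 + β) with hθ
  have hθ0 : 0 < θ := by positivity
  have hθ1 : θ ≤ 1 := by rw [hθ, div_le_one (by positivity)]; linarith
  have hβθ : β * θ ≤ 1 := by
    rw [hθ, mul_one_div, div_le_one (by positivity)]; linarith
  set D : ℝ := 2 * Real.exp (1 + r + 1 * r) * θ ^ (-r) + r ^ r with hD
  refine ⟨c * 3 ^ (-s) / 4, by positivity, ?_⟩
  refine liminf_pos_of_eventually_le (n₀ := 1) (Q := D ^ 2 * Real.exp 3) fun n hn => ?_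
  have hn1 : (1 : ℝ) ≤ n := by exact_mod_cast hn
  have hn0 : (0 : ℝ) < n := by linarith
  have hlog : 0 ≤ Real.log n := Real.log_nonneg hn1
  set x : ℝ := Real.exp (Real.log n / (2 * β)) with hx
  have hx1 : 1 ≤ x := Real.one_le_exp (by positivity)
  set U : ℝ := 2 * x with hU
  have hU2 : 2 ≤ U := by linarith
  set y : ℝ := U ^ 2 / 4 with hy
  have hyx : y = x ^ 2 := by rw [hy, hU]; ring
  have hy0 : 0 < y := by positivity
  have hyr : y ^ (-r) = Real.exp (-(Real.log n / 2)) := by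
    rw [hyx, hx, ← Real.exp_nat_mul, ← Real.exp_mul, hr]
    congr 1
    push_cast
    field_simp
  set T : ℝ := θ * U ^ 2 with hT
  have hT0 : 0 < T := by positivity
  have hTy : T = 4 * (θ * y) := by rw [hT, hy]; ring
  set q : ℝ := T / (1 + T) with hq
  have hq0 : 0 ≤ q := by positivity
  have hq1 : q < 1 := by rw [hq, div_lt_one (by positivity)]; linarith
  have hw := isCompoundWeights_negativeBinomial hr0 hq0 hq1
  set a : ℕ → ℝ := fun k => r * (q ^ k / k) with ha
  have hgen : ∀ z : ℝ, 0 ≤ z → z ≤ 1 → genExponent a z = -(r * Real.log (1 + T * (1 - z))) := by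
    intro z hz0 hz1
    have h1 : 0 < 1 - q := by linarith
    have h2 : 0 < 1 + T * (1 - z) := by
      have := mul_nonneg hT0.le (sub_nonneg.2 hz1)
      linarith
    have h3 : 1 - q * z = (1 - q) * (1 + T * (1 - z)) := by
      rw [hq]; field_simp; ring
    rw [ha, genExponent_logSeries hq0 hq1 hz0 hz1, h3, Real.log_mul h1.ne' h2.ne']
    ring
  set τ2 : ℝ≥0 := Real.toNNReal (2 / U ^ 2) with hτ2
  have hτ : (τ2 : ℝ) = 2 / U ^ 2 := Real.coe_toNNReal _ (by positivity)
  have hUτ : U ^ 2 * τ2 = 2 := by rw [hτ]; field_simp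
  have hTτ : T * τ2 = 2 * θ := by rw [hT, mul_assoc, hUτ, mul_comm]
  have hz : ∀ t : ℝ, 0 ≤ t → Real.exp (-t * τ2) ≤ 1 := fun t ht =>
    Real.exp_le_one_iff.2 (by rw [neg_mul]; exact neg_nonpos.2 (mul_nonneg ht τ2.2))
  have hzle : ∀ t : ℝ, T * (1 - Real.exp (-t * τ2)) ≤ 2 * θ * t := by
    intro t
    have h1 := one_sub_le_exp_neg_sub (t * τ2)
    rw [← neg_mul] at h1
    calc T * (1 - Real.exp (-t * τ2)) ≤ T * (t * τ2) := by gcongr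
      _ = 2 * θ * t := by rw [mul_left_comm, hTτ, mul_comm]
  set δ : ℝ := 2 * Real.exp (1 + genExponent a (Real.exp (-(U ^ 2 / 4) * τ2)) -
    genExponent a (Real.exp (-(1 / 4) * τ2))) + Real.exp (-(U ^ 2 / 4)) with hδ
  have hδ0 : 0 ≤ δ := by positivity
  have hδD : δ ≤ D * Real.exp (-(Real.log n / 2)) := by
    have e1 : genExponent a (Real.exp (-(U ^ 2 / 4) * τ2)) ≤ Real.log (θ * y) * -r := by
      rw [hgen _ (Real.exp_pos _).le (hz _ (by positivity)), mul_neg, neg_le_neg_iff, mul_comm]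
      gcongr
      have h1 : Real.exp (-(U ^ 2 / 4) * τ2) ≤ 2 / 3 := by
        rw [neg_mul, div_mul_eq_mul_div, hUτ, Real.exp_neg,
          inv_le_comm₀ (Real.exp_pos _) (by norm_num)]
        have := Real.add_one_le_exp (2 / 4 : ℝ)
        linarith
      have h2 : T * (1 / 3) ≤ T * (1 - Real.exp (-(U ^ 2 / 4) * τ2)) := by
        gcongr
        linarith
      rw [hTy] at h2 ⊢
      linarith [mul_pos hθ0 hy0]
    have e2 : -(1 * r) ≤ genExponent a (Real.exp (-(1 / 4) * τ2)) := by
      rw [hgen _ (Real.exp_pos _).le (hz _ (by positivity)), neg_le_neg_iff, mul_comm]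
      gcongr
      have h0 : 0 ≤ T * (1 - Real.exp (-(1 / 4) * τ2)) :=
        mul_nonneg hT0.le (sub_nonneg.2 (hz _ (by positivity)))
      have h1 := Real.log_le_sub_one_of_pos
        (by linarith : 0 < 1 + T * (1 - Real.exp (-(1 / 4) * τ2)))
      have h2 := hzle (1 / 4)
      linarith
    -- The inequality `y / r ≤ e ^ (y / r)` raised to the power `r`: the Gaussian remainder is
    -- negligible against `y ^ (-r) = n ^ (-1/2)`.
    have e3 : Real.exp (-(U ^ 2 / 4)) ≤ r ^ r * y ^ (-r) := by
      have h1 : y / r ≤ Real.exp (y / r) := by linarith [Real.add_one_le_exp (y / r)]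
      have h2 : (y / r) ^ r ≤ Real.exp y := by
        refine (Real.rpow_le_rpow (by positivity) h1 hr0.le).trans (le_of_eq ?_)
        rw [← Real.exp_mul, div_mul_cancel₀ _ hr0.ne']
      rw [Real.div_rpow hy0.le hr0.le, div_le_iff₀ (by positivity)] at h2
      rw [← hy, Real.exp_neg, Real.rpow_neg hy0.le, ← div_eq_mul_inv,
        le_div_iff₀ (by positivity), inv_mul_le_iff₀ (Real.exp_pos _)]
      exact h2
    have e4 : Real.exp (Real.log (θ * y) * -r) = θ ^ (-r) * y ^ (-r) := by
      rw [← Real.rpow_def_of_pos (by positivity), Real.mul_rpow hθ0.le hy0.le]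
    calc δ ≤ 2 * Real.exp ((1 + r + 1 * r) + Real.log (θ * y) * -r) + r ^ r * y ^ (-r) := by
          rw [hδ]
          gcongr 2 * Real.exp ?_ + ?_
          linarith
      _ = D * y ^ (-r) := by rw [Real.exp_add, e4, hD]; ring
      _ = _ := by rw [hyr]
  refine hmain _ _ 0 τ2 1 U δ b _ _ _ n _ hw zero_le_one le_rfl hU2 ?_
    (damped_baseLaw_le hw τ2 b U) (mul_sq_le_of_le_exp (by omega) hδ0 hδD) ?_ (by positivity)
    (by positivity) ?_
  · calc Real.exp (-(U ^ 2 / 2)) ≤ Real.exp (-(U ^ 2 / 4)) := by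
          rw [Real.exp_le_exp]; nlinarith
      _ ≤ δ := by rw [hδ]; exact le_add_of_nonneg_left (by positivity)
  · intro κ' h0 h1 ν hν
    refine ⟨by rw [hν, levyMeasure_singleton_zero]; rfl, univ_le hw h0 h1 hν ?_, fun u => ?_⟩
    · have h2 := mul_le_mul_of_nonneg_right (tsum_logSeries_mean hq0 hq1 hr0.le) τ2.coe_nonneg
      have h3 : q / (1 - q) = T := by rw [hq]; field_simp; ring
      rw [h3, mul_assoc, hTτ, hr, show β / 2 * (2 * θ) = β * θ by ring] at h2
      rw [NNReal.coe_zero]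
      linarith
    · refine le_trans ?_ (le_norm_levyCharFun hw h0 h1 hν b u)
      refine mul_le_mul (inv_le_exp_neg_three hCbar) ?_ (by positivity) (Real.exp_pos _).le
      have hu : 0 ≤ u ^ 2 / 2 := by positivity
      have h2 : 0 ≤ T * (1 - Real.exp (-(u ^ 2 / 2) * τ2)) :=
        mul_nonneg hT0.le (sub_nonneg.2 (hz _ hu))
      have hpos : 0 < 1 + |u| := by positivity
      rw [hgen _ (Real.exp_pos _).le (hz _ hu), Real.rpow_def_of_pos hpos, Real.exp_le_exp, mul_neg,
        neg_le_neg_iff]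
      have h4 : Real.log (1 + T * (1 - Real.exp (-(u ^ 2 / 2) * τ2))) ≤
          Real.log ((1 + |u|) ^ 2) := by
        refine Real.log_le_log (by linarith) ?_
        have h5 := hzle (u ^ 2 / 2)
        nlinarith [sq_abs u, abs_nonneg u, mul_le_mul_of_nonneg_right hθ1 (sq_nonneg u)]
      rw [Real.log_pow] at h4
      push_cast at h4
      calc _ ≤ r * (2 * Real.log (1 + |u|)) := by gcongr
        _ = _ := by rw [hr]; ring
  · have hrate : (n : ℝ) ^ (s / (2 * β)) = x ^ s := by
      rw [hx, ← Real.exp_mul, Real.rpow_def_of_pos hn0]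
      congr 1
      ring
    rw [hrate]
    exact lt_rate_mul hc (by norm_num) (by linarith) hs.le (by linarith) (by linarith)

end Assembly

end LevyLower

end

theorem theorem4p4 :
    (∀ σ : ℝ, 0 < σ → ∃ C₀ : ℝ, 0 < C₀ ∧ ∀ C : ℝ, C₀ ≤ C →
      ∀ b s : ℝ, 0 < s → ∃ ε : ℝ, 0 < ε ∧
        0 < liminf (fun n : ℕ => LevyLower.minimaxProb b s (LevyLower.classA C σ)
          (Real.log n ^ (s / 2)) ε n) atTop) ∧
    (∃ C₀ Cbar₀ : ℝ, 0 < C₀ ∧ 0 < Cbar₀ ∧ ∀ C Cbar : ℝ, C₀ ≤ C → Cbar₀ ≤ Cbar →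
      (∀ α : ℝ, 0 < α → ∀ b s : ℝ, 0 < s → ∃ ε : ℝ, 0 < ε ∧
        0 < liminf (fun n : ℕ => LevyLower.minimaxProb b s (LevyLower.classB b C Cbar α)
          (Real.log n ^ s) ε n) atTop) ∧
      (∀ β : ℝ, 0 ≤ β → ∀ b s : ℝ, 0 < s → ∃ ε : ℝ, 0 < ε ∧
        0 < liminf (fun n : ℕ => LevyLower.minimaxProb b s (LevyLower.classC b C Cbar β)
          ((n : ℝ) ^ LevyLower.polyExponent s β) ε n) atTop)) := by
  -- The `2` in the mass bounds comes from the standard Gaussian jumps and the perturbed ones, each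
  -- of second moment at most `1`; the third unit in `3` is for the variance part.
  refine ⟨fun σ hσ => ⟨σ ^ 2 + 2, by positivity, fun C hC b s hs =>
    LevyLower.minimax_gaussian hσ hC b s hs⟩, 3, Real.exp 3, by norm_num, Real.exp_pos _,
    fun C Cbar hC hCbar => ⟨fun α hα b s hs =>
      LevyLower.minimax_exponential hC hCbar hα b s hs, fun β hβ b s hs => ?_⟩⟩
  rcases hβ.eq_or_lt with rfl | hβ0
  · simpa [LevyLower.polyExponent] using LevyLower.minimax_parametric hC hCbar le_rfl b s hs
  · rw [LevyLower.polyExponent, if_neg hβ0.ne']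
    -- Both rates are lower bounds for every `β > 0`, so whichever attains the minimum is available.
    rcases min_choice (s / (2 * β)) (1 / 2 : ℝ) with h | h
    · rw [h]
      exact LevyLower.minimax_polynomial hC hCbar hβ0 b s hs
    · rw [h]
      exact LevyLower.minimax_parametric hC hCbar hβ b s hs
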